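/- Let $\mathbb D$ be the open unit disc of $\mathbb C$ and let $1\le p<\infty$. Let $RM(p,1)$ be the space of holomorphic functions $f$ on $\mathbb D$ with $$\rho_{p,1}(f)=\frac1{2\pi}\int_0^{2\pi}\Big(\int_0^1|f(re^{it})|^p\,dr\Big)^{1/p}dt<\infty,$$ normed by $\rho_{p,1}$. Let $g$ belong to the Bloch space $\mathcal B$, that is, let $g$ be holomorphic on $\mathbb D$ with $\sup_{z\in\mathbb D}(1-|z|^2)|g'(z)|<\infty$. Then the integration operator $$T_g(f)(z)=\int_0^z f(\zeta)g'(\zeta)\,d\zeta,\qquad z\in\mathbb D,$$ is a well-defined bounded linear operator from $RM(p,1)$ to itself, and the following are equivalent: 1. $T_g:RM(p,1)\to RM(p,1)$ is not compact; 2. the adjoint $T_g^*:RM(p,1)^*\to RM(p,1)^*$ fixes a copy of $c_0$; 3. $T_g$ fixes a copy of $\ell^1$. Here $c_0$ and $\ell^1$ are the usual complex sequence spaces, and a bounded linear operator $T:X\to Y$ between complex normed spaces *fixes a copy* of a Banach space $E$ if there is a closed subspace $M$ of $X$, linearly homeomorphic to $E$, such that $T|_M$ is an isomorphism onto its image, i.e.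 $\|Tx\|\ge c\|x\|$ for all $x\in M$ and some constant $c>0$. -/

import Mathlib

open Set MeasureTheory Metric
open scoped ENNReal Topology ZeroAtInfty

noncomputable section

namespace RadialMean

/-! ### The average radial integrability spaces `RM(p,q)`, for `1 ≤ p, q < ∞` -/

/-- The inner radial mean `(∫₀¹ |f(r e^{it})|^p dr)^{1/p}`, as an extended nonnegative number. -/
def radialMean (p : ℝ) (f : ℂ → ℂ) (t : ℝ) : ℝ≥0∞ :=
  (∫⁻ r in Ico (0 : ℝ) 1, ‖f (r * Complex.exp (t * Complex.I))‖ₑ ^ p) ^ (1 / p)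

/-- `ρ_{p,q}(f) = ((1/2π) ∫₀^{2π} (∫₀¹ |f(r e^{it})|^p dr)^{q/p} dt)^{1/q}`,
as an extended nonnegative number. -/
def rho (p q : ℝ) (f : ℂ → ℂ) : ℝ≥0∞ :=
  ((ENNReal.ofReal (2 * Real.pi))⁻¹ *
    ∫⁻ t in Ioc (0 : ℝ) (2 * Real.pi), radialMean p f t ^ q) ^ (1 / q)

/-- Holomorphic functions on the open unit disc. A function on the disc is represented by its
extension by zero to `ℂ`, so that two elements are equal exactly when they agree on the disc. -/
def IsHolo (f : ℂ → ℂ) : Prop :=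
  DifferentiableOn ℂ f (ball 0 1) ∧ ∀ z, z ∉ ball (0 : ℂ) 1 → f z = 0

theorem IsHolo.measurable {f : ℂ → ℂ} (hf : IsHolo f) : Measurable f := by
  classical
  have h := (hf.1.continuousOn).measurable_piecewise (g := fun _ => (0 : ℂ)) continuousOn_const
    (measurableSet_ball (x := (0 : ℂ)) (ε := 1))
  convert h using 1
  ext z
  by_cases hz : z ∈ ball (0 : ℂ) 1
  · simp [Set.piecewise, hz]
  · simp only [Set.piecewise, hz, if_false]
    exact hf.2 z hz

theorem measurable_polar {f : ℂ → ℂ} (hf : Measurable f) :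
    Measurable (fun x : ℝ × ℝ => f (x.2 * Complex.exp (x.1 * Complex.I))) :=
  hf.comp (by fun_prop)

theorem measurable_ray {f : ℂ → ℂ} (hf : Measurable f) (t : ℝ) :
    Measurable (fun r : ℝ => f (r * Complex.exp (t * Complex.I))) :=
  hf.comp (by fun_prop)

theorem measurable_radialMean {f : ℂ → ℂ} (hf : Measurable f) (p : ℝ) :
    Measurable (radialMean p f) := by
  unfold radialMean
  refine Measurable.pow_const ?_ _
  exact Measurable.lintegral_prod_right' (ν := volume.restrict (Ico (0 : ℝ) 1))
    (f := fun x : ℝ × ℝ => ‖f (x.2 * Complex.exp (x.1 * Complex.I))‖ₑ ^ p)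
    ((measurable_polar hf).enorm.pow_const p)

theorem radialMean_zero {p : ℝ} (hp : 1 ≤ p) (t : ℝ) : radialMean p 0 t = 0 := by
  have h0 : 0 < p := by linarith
  simp [radialMean, h0]

theorem rho_zero {p q : ℝ} (hp : 1 ≤ p) (hq : 1 ≤ q) : rho p q 0 = 0 := by
  have h0 : 0 < q := by linarith
  simp [rho, radialMean_zero hp, h0]

theorem radialMean_smul {p : ℝ} (hp : 1 ≤ p) (c : ℂ) (f : ℂ → ℂ) (t : ℝ) :
    radialMean p (c • f) t = ‖c‖ₑ * radialMean p f t := by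
  have h0 : 0 < p := by linarith
  simp only [radialMean, Pi.smul_apply, smul_eq_mul, enorm_mul]
  simp_rw [ENNReal.mul_rpow_of_nonneg _ _ h0.le]
  rw [lintegral_const_mul' _ _ (by simp [h0.le]),
    ENNReal.mul_rpow_of_nonneg _ _ (by positivity), ← ENNReal.rpow_mul,
    mul_one_div_cancel h0.ne', ENNReal.rpow_one]

theorem rho_smul {p q : ℝ} (hp : 1 ≤ p) (hq : 1 ≤ q) (c : ℂ) (f : ℂ → ℂ) :
    rho p q (c • f) = ‖c‖ₑ * rho p q f := by
  have h0 : 0 < q := by linarith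
  simp only [rho, radialMean_smul hp]
  simp_rw [ENNReal.mul_rpow_of_nonneg _ _ h0.le]
  rw [lintegral_const_mul' _ _ (by simp [h0.le]), mul_left_comm,
    ENNReal.mul_rpow_of_nonneg (‖c‖ₑ ^ q) _ (by positivity), ← ENNReal.rpow_mul,
    mul_one_div_cancel h0.ne', ENNReal.rpow_one, ENNReal.mul_rpow_of_nonneg _ _ (by positivity)]

theorem radialMean_add_le {p : ℝ} (hp : 1 ≤ p) {f g : ℂ → ℂ} (hf : Measurable f)
    (hg : Measurable g) (t : ℝ) :
    radialMean p (f + g) t ≤ radialMean p f t + radialMean p g t := by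
  refine le_trans ?_ (ENNReal.lintegral_Lp_add_le (μ := volume.restrict (Ico (0 : ℝ) 1))
    (measurable_ray hf t).enorm.aemeasurable (measurable_ray hg t).enorm.aemeasurable hp)
  unfold radialMean
  have h0 : 0 < p := by linarith
  gcongr with r
  exact enorm_add_le _ _

theorem rho_add_le {p q : ℝ} (hp : 1 ≤ p) (hq : 1 ≤ q) {f g : ℂ → ℂ} (hf : Measurable f)
    (hg : Measurable g) : rho p q (f + g) ≤ rho p q f + rho p q g := by
  have h0 : 0 < q := by linarith
  have h1 : (0 : ℝ) ≤ 1 / q := by positivity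
  unfold rho
  rw [ENNReal.mul_rpow_of_nonneg _ _ h1, ENNReal.mul_rpow_of_nonneg _ _ h1,
    ENNReal.mul_rpow_of_nonneg _ _ h1, ← mul_add]
  gcongr
  refine le_trans ?_ (ENNReal.lintegral_Lp_add_le
    (μ := volume.restrict (Ioc (0 : ℝ) (2 * Real.pi)))
    (measurable_radialMean hf p).aemeasurable (measurable_radialMean hg p).aemeasurable hq)
  gcongr with t
  exact radialMean_add_le hp hf hg t

theorem eq_zero_of_rho_eq_zero {p q : ℝ} (hp : 1 ≤ p) (hq : 1 ≤ q) {f : ℂ → ℂ} (hf : IsHolo f)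
    (h : rho p q f = 0) : f = 0 := by
  have hp0 : 0 < p := by linarith
  have hq0 : 0 < q := by linarith
  have hm := measurable_radialMean hf.measurable p
  have h1 : ∫⁻ t in Ioc (0 : ℝ) (2 * Real.pi), radialMean p f t ^ q = 0 := by
    unfold rho at h
    rw [ENNReal.rpow_eq_zero_iff_of_pos (by positivity), mul_eq_zero] at h
    rcases h with h | h
    · exact absurd (ENNReal.inv_eq_zero.1 h) ENNReal.ofReal_ne_top
    · exact h
  rw [lintegral_eq_zero_iff (hm.pow_const q)] at h1
  have hne : (ae (volume.restrict (Ioc (0 : ℝ) (2 * Real.pi)))).NeBot := by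
    rw [ae_neBot, Ne, Measure.restrict_eq_zero]
    simp [Real.volume_Ioc, Real.pi_pos]
  obtain ⟨t, ht⟩ := h1.exists
  simp only [Pi.zero_apply, ENNReal.rpow_eq_zero_iff_of_pos hq0] at ht
  unfold radialMean at ht
  rw [ENNReal.rpow_eq_zero_iff_of_pos (by positivity),
    lintegral_eq_zero_iff ((measurable_ray hf.measurable t).enorm.pow_const p)] at ht
  have ht' : ∀ᵐ r : ℝ, r ∈ Ico (0 : ℝ) 1 → f (r * Complex.exp (t * Complex.I)) = 0 := by
    rw [← ae_restrict_iff' measurableSet_Ico]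
    filter_upwards [ht] with r hr
    simpa [ENNReal.rpow_eq_zero_iff_of_pos hp0] using hr
  have hfreq : ∃ᶠ z in 𝓝[≠] (0 : ℂ), f z = 0 := by
    rw [Filter.frequently_iff]
    intro U hU
    obtain ⟨ε, hε, hU⟩ := Metric.mem_nhdsWithin_iff.1 hU
    have hδ : (0 : ℝ) < min ε 1 := lt_min hε one_pos
    have hne' : (ae (volume.restrict (Ioo (0 : ℝ) (min ε 1)))).NeBot := by
      rw [ae_neBot, Ne, Measure.restrict_eq_zero]
      simp [Real.volume_Ioo, hε]
    obtain ⟨r, hr, hr'⟩ := ((ae_restrict_of_ae ht').and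
      (ae_restrict_mem (μ := volume) (measurableSet_Ioo (a := (0 : ℝ)) (b := min ε 1)))).exists
    refine ⟨r * Complex.exp (t * Complex.I), hU ⟨?_, ?_⟩,
      hr ⟨hr'.1.le, hr'.2.trans_le (min_le_right _ _)⟩⟩
    · simp only [mem_ball, dist_zero_right, norm_mul, Complex.norm_real, Real.norm_eq_abs,
        Complex.norm_exp_ofReal_mul_I, mul_one, abs_of_pos hr'.1]
      exact hr'.2.trans_le (min_le_left _ _)
    · simpa using hr'.1.ne'
  have hz := (hf.1.analyticOnNhd isOpen_ball).eqOn_zero_of_preconnected_of_frequently_eq_zero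
    (convex_ball (0 : ℂ) 1).isPreconnected (mem_ball_self one_pos) hfreq
  ext z
  by_cases hz' : z ∈ ball (0 : ℂ) 1
  · exact hz hz'
  · exact hf.2 z hz'

/-- The linear space underlying `RM(p,q)`. -/
def rmSubmodule (p q : ℝ) [hp : Fact (1 ≤ p)] [hq : Fact (1 ≤ q)] : Submodule ℂ (ℂ → ℂ) where
  carrier := {f | IsHolo f ∧ rho p q f < ∞}
  zero_mem' := ⟨⟨differentiableOn_const 0, fun _ _ => rfl⟩, by simp [rho_zero hp.out hq.out]⟩
  add_mem' {f g} hf hg := by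
    refine ⟨⟨hf.1.1.add hg.1.1, fun z hz => ?_⟩,
      (rho_add_le hp.out hq.out hf.1.measurable hg.1.measurable).trans_lt
        (ENNReal.add_lt_top.2 ⟨hf.2, hg.2⟩)⟩
    simp [hf.1.2 z hz, hg.1.2 z hz]
  smul_mem' c f hf := by
    refine ⟨⟨hf.1.1.const_smul c, fun z hz => ?_⟩, ?_⟩
    · simp [hf.1.2 z hz]
    · rw [rho_smul hp.out hq.out]
      exact ENNReal.mul_lt_top enorm_lt_top hf.2

/-- The space `RM(p,q)` of holomorphic functions on the unit disc with `ρ_{p,q}(f) < ∞`.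
It is a type of its own, so that its topology is the one of the norm `ρ_{p,q}`. -/
def RM (p q : ℝ) [Fact (1 ≤ p)] [Fact (1 ≤ q)] : Type := rmSubmodule p q

variable {p q : ℝ} [hp : Fact (1 ≤ p)] [hq : Fact (1 ≤ q)]

instance : AddCommGroup (RM p q) := inferInstanceAs (AddCommGroup (rmSubmodule p q))

instance : Module ℂ (RM p q) := inferInstanceAs (Module ℂ (rmSubmodule p q))

instance : CoeFun (RM p q) (fun _ => ℂ → ℂ) := ⟨fun f => f.1⟩

/-- The norm of `RM(p,q)` is `ρ_{p,q}`. -/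
instance : NormedAddCommGroup (RM p q) :=
  AddGroupNorm.toNormedAddCommGroup
    { toFun := fun f => (rho p q f).toReal
      map_zero' := by
        change (rho p q 0).toReal = 0
        simp [rho_zero hp.out hq.out]
      add_le' := fun f g => by
        change (rho p q ((f : ℂ → ℂ) + g)).toReal ≤ _
        rw [← ENNReal.toReal_add f.2.2.ne g.2.2.ne]
        exact ENNReal.toReal_mono (ENNReal.add_ne_top.2 ⟨f.2.2.ne, g.2.2.ne⟩)
          (rho_add_le hp.out hq.out f.2.1.measurable g.2.1.measurable)
      neg' := fun f => by
        have h : ((-f : RM p q) : ℂ → ℂ) = (-1 : ℂ) • (f : ℂ → ℂ) := by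
          rw [neg_one_smul]
          rfl
        rw [h, rho_smul hp.out hq.out]
        simp
      eq_zero_of_map_eq_zero' := fun f hf => by
        rw [ENNReal.toReal_eq_zero_iff] at hf
        exact Subtype.ext
          (eq_zero_of_rho_eq_zero hp.out hq.out f.2.1 (hf.resolve_right f.2.2.ne)) }

theorem norm_def (f : RM p q) : ‖f‖ = (rho p q f).toReal := rfl

instance : NormedSpace ℂ (RM p q) where
  norm_smul_le c f := by
    rw [norm_def, norm_def]
    change (rho p q (c • (f : ℂ → ℂ))).toReal ≤ _
    rw [rho_smul hp.out hq.out, ENNReal.toReal_mul, toReal_enorm]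

instance : Fact ((1 : ℝ) ≤ 1) := ⟨le_rfl⟩

/-! ### The Bloch space and the integration operator -/

/-- `g` is holomorphic on the unit disc and `sup_{|z|<1} (1 - |z|²) |g'(z)| < ∞`.
The values of `g` off the disc play no role. -/
def IsBloch (g : ℂ → ℂ) : Prop :=
  DifferentiableOn ℂ g (ball 0 1) ∧ ∃ C : ℝ, ∀ z ∈ ball (0 : ℂ) 1, (1 - ‖z‖ ^ 2) * ‖deriv g z‖ ≤ C

/-- `∫₀^z f(ζ) g'(ζ) dζ`, the integral being taken along the segment from `0` to `z`. -/
def integrationOp (g f : ℂ → ℂ) (z : ℂ) : ℂ :=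
  ∫ s in (0 : ℝ)..1, f (s * z) * deriv g (s * z) * z

/-! ### Operators fixing copies of Banach spaces -/

/-- `T : X → Y` fixes a copy of `E`: there is a closed subspace `M` of `X`, isomorphic to `E`,
such that the restriction of `T` to `M` is an isomorphism onto its image. -/
def FixesCopy (E : Type*) [NormedAddCommGroup E] [NormedSpace ℂ E]
    {X Y : Type*} [NormedAddCommGroup X] [NormedSpace ℂ X]
    [NormedAddCommGroup Y] [NormedSpace ℂ Y] (T : X →L[ℂ] Y) : Prop :=
  ∃ M : Submodule ℂ X, IsClosed (M : Set X) ∧ Nonempty (M ≃L[ℂ] E) ∧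
    ∃ c : ℝ, 0 < c ∧ ∀ x ∈ M, c * ‖x‖ ≤ ‖T x‖

/-- The Banach space adjoint `T* : Y* → X*`, `T* φ = φ ∘ T`. -/
def dualMap {X Y : Type*} [NormedAddCommGroup X] [NormedSpace ℂ X]
    [NormedAddCommGroup Y] [NormedSpace ℂ Y] (T : X →L[ℂ] Y) :
    StrongDual ℂ Y →L[ℂ] StrongDual ℂ X :=
  ContinuousLinearMap.precomp ℂ T

/-- The complex sequence space `c₀`: null sequences with the supremum norm. -/
abbrev SeqC0 : Type := C₀(ℕ, ℂ)

/-- The complex sequence space `ℓ¹`. -/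
abbrev SeqL1 : Type := lp (fun _ : ℕ => ℂ) 1

end RadialMean

end

/-! The dividing line is the little Bloch condition `(1 - |z|) |g'(z)| → 0` as `|z| → 1`.

If it holds, `T` is a norm limit of finite-rank operators composed with `T`: dilate `T f`, truncate
the Taylor series, and control the difference `T f (z) - T f (s z)` by the smallness of `g'` near
the circle (`isCompactOperator_of_little_bloch`).

If it fails, there are points `w n → ζ` with `|ζ| = 1` and `(1 - |w n|) |g'(w n)| > ε`. Normalised
kernels peaking at `w n` are bounded in `RM(p,1)`, while their images stay bounded below because `(T
f)'(w) = f(w) g'(w)` and derivative evaluation is bounded with the matching power of `1 - |w|`.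
Hardy's inequality holds ray by ray, so the radial means of the images are dominated by those of the
kernels and tend to `0` for every angle except that of `ζ`. The norm is an `L¹` norm in the angle,
so a gliding hump (`exists_almost_disjoint`) gives a subsequence of images essentially carried by
disjoint sets of angles, and Hahn–Banach functionals attached to these sets are almost biorthogonal
to the images. This single system produces both the copy of `ℓ¹` fixed by `T` and the copy of `c₀`
fixed by its adjoint.

Conversely, the unit vectors of either sequence space are uniformly separated, so a fixed copy
excludes compactness; for the adjoint this needs half of Schauder's theorem. -/

noncomputable section

namespace RadialMean

/-! ### Fixed copies of sequence spaces: a construction from almost biorthogonal systems, and the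
obstruction to compactness -/

section FixedCopies

variable {E X Y : Type*} [NormedAddCommGroup E] [NormedSpace ℂ E]
  [NormedAddCommGroup X] [NormedSpace ℂ X] [NormedAddCommGroup Y] [NormedSpace ℂ Y]

/-- If `T ∘ J` is bounded below then so is `J`, since `T` is bounded. Completeness of `E` then makes
the range of `J` closed, and this range is the required subspace. -/
theorem fixesCopy_of_bound [CompleteSpace E] (T : X →L[ℂ] Y) (J : E →L[ℂ] X) {c : ℝ} (hc : 0 < c)
    (h : ∀ a, c * ‖a‖ ≤ ‖T (J a)‖) : FixesCopy E T := by
  have hb : ∀ a, ‖a‖ ≤ (‖T‖ / c) * ‖J a‖ := fun a => by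
    have := (h a).trans (T.le_opNorm (J a))
    rw [div_mul_eq_mul_div, le_div_iff₀ hc]
    linarith
  have hT : 0 ≤ ‖T‖ / c := by positivity
  have hanti : AntilipschitzWith (‖T‖ / c).toNNReal J := by
    refine J.antilipschitz_of_bound fun a => ?_
    rw [Real.coe_toNNReal _ hT]
    exact hb a
  refine ⟨LinearMap.range J.toLinearMap, ?_, ⟨?_⟩, c / (‖J‖ + 1), by positivity, ?_⟩
  · have := hanti.isClosed_range J.uniformContinuous
    convert this using 1
    ext x
    simp
  · refine ((LinearEquiv.ofInjective J.toLinearMap hanti.injective).toContinuousLinearEquivOfBounds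
      ‖J‖ (‖T‖ / c) (fun a => J.le_opNorm a) fun x => ?_).symm
    obtain ⟨a, rfl⟩ := (LinearEquiv.ofInjective J.toLinearMap hanti.injective).surjective x
    rw [LinearEquiv.symm_apply_apply]
    exact hb a
  · rintro _ ⟨a, rfl⟩
    refine le_trans ?_ (h a)
    have h1 : ‖J a‖ ≤ (‖J‖ + 1) * ‖a‖ := (J.le_opNorm a).trans (by gcongr; linarith)
    calc c / (‖J‖ + 1) * ‖J a‖ ≤ c / (‖J‖ + 1) * ((‖J‖ + 1) * ‖a‖) := by gcongr
      _ = c * ‖a‖ := by field_simp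

theorem seqL1_hasSum_norm (a : SeqL1) : HasSum (fun n => ‖a n‖) ‖a‖ := by
  simpa using lp.hasSum_norm (p := 1) (by simp) a

theorem exists_seqL1_map [CompleteSpace X] {f : ℕ → X} {C : ℝ} (hf : ∀ n, ‖f n‖ ≤ C) :
    ∃ J : SeqL1 →L[ℂ] X, ∀ a : SeqL1, HasSum (fun n => a n • f n) (J a) := by
  have hb : ∀ (a : SeqL1) (n : ℕ), ‖a n • f n‖ ≤ ‖a n‖ * C := fun a n => by
    rw [norm_smul]
    gcongr
    exact hf n
  have hs : ∀ a : SeqL1, Summable fun n => a n • f n := fun a =>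
    Summable.of_norm_bounded ((seqL1_hasSum_norm a).summable.mul_right C) (hb a)
  refine ⟨LinearMap.mkContinuous
    { toFun := fun a => ∑' n, a n • f n
      map_add' := fun a b => ?_
      map_smul' := fun c a => ?_ } C fun a => ?_, fun a => (hs a).hasSum⟩
  · rw [← (hs a).tsum_add (hs b)]
    simp [add_smul]
  · simp [mul_smul, (hs a).tsum_const_smul c]
  · have := tsum_of_norm_bounded ((seqL1_hasSum_norm a).mul_right C) (hb a)
    simpa [mul_comm] using this

/-- The matrix `φ m (T (f n))` is diagonally dominant by columns: diagonal at least `c`,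
off-diagonal column sums at most `ε`. Acting on `ℓ¹` it is therefore bounded below by `c - ε`, and
the `ℓ¹` norm of its output is at most `K ‖T (J a)‖`. -/
theorem fixesCopy_seqL1 [CompleteSpace X] (T : X →L[ℂ] Y) {f : ℕ → X} {φ : ℕ → StrongDual ℂ Y}
    {C K c ε : ℝ} (hf : ∀ n, ‖f n‖ ≤ C) (hφ : ∀ (y : Y) (s : Finset ℕ), ∑ n ∈ s, ‖φ n y‖ ≤ K * ‖y‖)
    (hd : ∀ n, c ≤ ‖φ n (T (f n))‖)
    (ho : ∀ (n : ℕ) (s : Finset ℕ), n ∉ s → ∑ m ∈ s, ‖φ m (T (f n))‖ ≤ ε) (hε : ε < c) :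
    FixesCopy SeqL1 T := by
  classical
  obtain ⟨J, hJ⟩ := exists_seqL1_map hf
  refine fixesCopy_of_bound T J (c := (c - ε) / (|K| + 1))
    (div_pos (by linarith) (by positivity)) fun a => ?_
  have hsm := seqL1_hasSum_norm a
  have key : ∀ s : Finset ℕ, c * ∑ m ∈ s, ‖a m‖ ≤ K * ‖T (J a)‖ + ε * ‖a‖ := by
    intro s
    -- The off-diagonal part of row `m`. Rows are summed over a finite set first, so that the sums
    -- can be exchanged and the column bound applied.
    set g : ℕ → ℕ → ℂ := fun m n => if n = m then 0 else a n * φ m (T (f n)) with hg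
    have hφJ : ∀ m, HasSum (fun n => a n * φ m (T (f n))) (φ m (T (J a))) := fun m => by
      simpa using ((φ m).comp T).hasSum (hJ a)
    have hgs : ∀ m, HasSum (g m) (φ m (T (J a)) - a m * φ m (T (f m))) := fun m => by
      have e : g m = fun n => a n * φ m (T (f n)) -
          if n = m then a m * φ m (T (f m)) else 0 := by
        funext n
        rcases eq_or_ne n m with rfl | h
        · simp [hg]
        · simp [hg, h]
      rw [e]
      exact (hφJ m).sub (hasSum_ite_eq m (a m * φ m (T (f m))))
    have hgn : ∀ m, Summable fun n => ‖g m n‖ := fun m => by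
      refine Summable.of_nonneg_of_le (fun n => norm_nonneg _) (fun n => ?_)
        (hsm.summable.mul_right (‖(φ m).comp T‖ * C))
      by_cases h : n = m
      · have : 0 ≤ C := (norm_nonneg _).trans (hf 0)
        simp only [hg, h, if_true, norm_zero]
        positivity
      · simp only [hg, h, if_false, norm_mul]
        gcongr
        exact (((φ m).comp T).le_opNorm (f n)).trans (by gcongr; exact hf n)
    have h1 : ∑ m ∈ s, ‖φ m (T (J a)) - a m * φ m (T (f m))‖ ≤ ε * ‖a‖ := by
      calc _ ≤ ∑ m ∈ s, ∑' n, ‖g m n‖ := by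
            refine Finset.sum_le_sum fun m _ => ?_
            rw [← (hgs m).tsum_eq]
            exact norm_tsum_le_tsum_norm (hgn m)
        _ = ∑' n, ∑ m ∈ s, ‖g m n‖ := (Summable.tsum_finsetSum fun m _ => hgn m).symm
        _ ≤ ∑' n, ε * ‖a n‖ := by
            refine Summable.tsum_le_tsum (fun n => ?_) (summable_sum fun m _ => hgn m)
              (hsm.summable.mul_left ε)
            calc ∑ m ∈ s, ‖g m n‖ = ∑ m ∈ s.erase n, ‖a n‖ * ‖φ m (T (f n))‖ := by
                  rw [← Finset.sum_erase s (a := n) (by simp [hg])]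
                  refine Finset.sum_congr rfl fun m hm => ?_
                  simp [hg, (Finset.ne_of_mem_erase hm).symm]
              _ = (∑ m ∈ s.erase n, ‖φ m (T (f n))‖) * ‖a n‖ := by
                  rw [← Finset.mul_sum, mul_comm]
              _ ≤ ε * ‖a n‖ := by
                  gcongr
                  exact ho n _ (Finset.notMem_erase n s)
        _ = ε * ‖a‖ := by rw [tsum_mul_left, hsm.tsum_eq]
    calc c * ∑ m ∈ s, ‖a m‖ = ∑ m ∈ s, c * ‖a m‖ := Finset.mul_sum _ _ _
      _ ≤ ∑ m ∈ s, (‖φ m (T (J a))‖ + ‖φ m (T (J a)) - a m * φ m (T (f m))‖) := by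
          refine Finset.sum_le_sum fun m _ => ?_
          calc c * ‖a m‖ ≤ ‖φ m (T (f m))‖ * ‖a m‖ := by gcongr; exact hd m
            _ = ‖a m * φ m (T (f m))‖ := by rw [norm_mul, mul_comm]
            _ ≤ _ := by
                have := norm_sub_norm_le (a m * φ m (T (f m))) (φ m (T (J a)))
                rw [norm_sub_rev] at this
                linarith
      _ ≤ K * ‖T (J a)‖ + ε * ‖a‖ := by
          rw [Finset.sum_add_distrib]
          exact add_le_add (hφ _ s) h1
  have h2 : c * ‖a‖ ≤ K * ‖T (J a)‖ + ε * ‖a‖ :=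
    le_of_tendsto (Filter.Tendsto.const_mul c (show Filter.Tendsto _ _ _ from hsm))
      (Filter.Eventually.of_forall key)
  -- `|K| + 1` is positive without any sign assumption on `K`.
  have h3 : K * ‖T (J a)‖ ≤ (|K| + 1) * ‖T (J a)‖ := by
    gcongr
    linarith [le_abs_self K]
  rw [div_mul_eq_mul_div, div_le_iff₀ (by positivity)]
  linarith

theorem seqC0_norm_apply_le (b : SeqC0) (n : ℕ) : ‖b n‖ ≤ ‖b‖ := by
  rw [← ZeroAtInftyContinuousMap.norm_toBCF_eq_norm]
  exact b.toBCF.norm_coe_le_norm n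

theorem seqC0_norm_le {b : SeqC0} {C : ℝ} (hC : 0 ≤ C) (h : ∀ n, ‖b n‖ ≤ C) : ‖b‖ ≤ C := by
  rw [← ZeroAtInftyContinuousMap.norm_toBCF_eq_norm]
  exact (BoundedContinuousFunction.norm_le hC).2 h

/-- The functionals form a weakly unconditionally Cauchy series, so bounded multipliers give
absolutely convergent sums at each `y`, with a bound linear in `‖b‖` and `‖y‖`. -/
theorem exists_seqC0_map {φ : ℕ → StrongDual ℂ Y} {K : ℝ}
    (hφ : ∀ (y : Y) (s : Finset ℕ), ∑ n ∈ s, ‖φ n y‖ ≤ K * ‖y‖) :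
    ∃ Q : SeqC0 →L[ℂ] StrongDual ℂ Y, ∀ (b : SeqC0) (y : Y), HasSum (fun n => b n * φ n y) (Q b y) := by
  have hsn : ∀ y : Y, Summable fun n => ‖φ n y‖ := fun y =>
    summable_of_sum_le (fun n => norm_nonneg _) (hφ y)
  have hb : ∀ (b : SeqC0) (y : Y) (n : ℕ), ‖b n * φ n y‖ ≤ ‖b‖ * ‖φ n y‖ := fun b y n => by
    rw [norm_mul]
    gcongr
    exact seqC0_norm_apply_le b n
  have hs : ∀ (b : SeqC0) (y : Y), Summable fun n => b n * φ n y := fun b y =>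
    Summable.of_norm_bounded ((hsn y).mul_left ‖b‖) (hb b y)
  have hbd : ∀ (b : SeqC0) (y : Y), ‖∑' n, b n * φ n y‖ ≤ K * ‖b‖ * ‖y‖ := fun b y => by
    refine (tsum_of_norm_bounded ((hsn y).hasSum.mul_left ‖b‖) (hb b y)).trans ?_
    have : ∑' n, ‖φ n y‖ ≤ K * ‖y‖ := Real.tsum_le_of_sum_le (fun n => norm_nonneg _) (hφ y)
    calc ‖b‖ * ∑' n, ‖φ n y‖ ≤ ‖b‖ * (K * ‖y‖) := by gcongr
      _ = _ := by ring
  refine ⟨LinearMap.mkContinuous₂ (LinearMap.mk₂ ℂ (fun (b : SeqC0) (y : Y) => ∑' n, b n * φ n y)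
    (fun b b' y => ?_) (fun c b y => ?_) (fun b y y' => ?_) (fun c b y => ?_)) K hbd,
    fun b y => (hs b y).hasSum⟩
  · rw [← (hs b y).tsum_add (hs b' y)]
    simp [add_mul]
  · simp [mul_assoc, tsum_mul_left]
  · rw [← (hs b y).tsum_add (hs b y')]
    simp [mul_add]
  · simp [mul_left_comm, tsum_mul_left]

/-- Testing `T* (Q b)` on `f m` reads column `m` of the same matrix: the term `b m * φ m (T (f m))`
dominates and the others contribute at most `ε ‖b‖`. Taking the supremum over `m` bounds `T* ∘ Q`
below. -/
theorem fixesCopy_seqC0_dualMap (T : X →L[ℂ] Y) {f : ℕ → X} {φ : ℕ → StrongDual ℂ Y}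
    {C K c ε : ℝ} (hf : ∀ n, ‖f n‖ ≤ C)
    (hφ : ∀ (y : Y) (s : Finset ℕ), ∑ n ∈ s, ‖φ n y‖ ≤ K * ‖y‖)
    (hd : ∀ n, c ≤ ‖φ n (T (f n))‖) (hε0 : 0 ≤ ε)
    (ho : ∀ (n : ℕ) (s : Finset ℕ), n ∉ s → ∑ m ∈ s, ‖φ m (T (f n))‖ ≤ ε) (hε : ε < c) :
    FixesCopy SeqC0 (dualMap T) := by
  classical
  obtain ⟨Q, hQ⟩ := exists_seqC0_map hφ
  have hC : 0 ≤ C := (norm_nonneg _).trans (hf 0)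
  have hc : 0 < c := by linarith
  refine fixesCopy_of_bound (dualMap T) Q (c := (c - ε) / (C + 1))
    (div_pos (by linarith) (by positivity)) fun b => ?_
  set N := ‖dualMap T (Q b)‖ with hN
  have key : ∀ m, c * ‖b m‖ ≤ N * C + ε * ‖b‖ := by
    intro m
    have h1 : ‖Q b (T (f m))‖ ≤ N * C :=
      ((dualMap T (Q b)).le_opNorm (f m)).trans (by gcongr; exact hf m)
    have h2 := (hQ b (T (f m))).sub (hasSum_ite_eq m (b m * φ m (T (f m))))
    have h3 : ‖Q b (T (f m)) - b m * φ m (T (f m))‖ ≤ ε * ‖b‖ := by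
      refine le_of_tendsto h2.norm (Filter.Eventually.of_forall fun s => ?_)
      calc ‖∑ n ∈ s, (b n * φ n (T (f m)) - if n = m then b m * φ m (T (f m)) else 0)‖
          = ‖∑ n ∈ s.erase m, b n * φ n (T (f m))‖ := by
            congr 1
            rw [← Finset.sum_erase s (a := m) (by simp)]
            refine Finset.sum_congr rfl fun n hn => ?_
            simp [Finset.ne_of_mem_erase hn]
        _ ≤ ∑ n ∈ s.erase m, ‖b‖ * ‖φ n (T (f m))‖ := by
            refine norm_sum_le_of_le _ fun n _ => ?_
            rw [norm_mul]
            gcongr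
            exact seqC0_norm_apply_le b n
        _ ≤ ε * ‖b‖ := by
            rw [← Finset.mul_sum, mul_comm]
            gcongr
            exact ho m _ (Finset.notMem_erase m s)
    have h4 : c * ‖b m‖ ≤ ‖b m * φ m (T (f m))‖ := by
      rw [norm_mul, mul_comm]
      gcongr
      exact hd m
    have h5 := norm_sub_norm_le (b m * φ m (T (f m))) (Q b (T (f m)))
    rw [norm_sub_rev] at h5
    linarith
  have h6 : ‖b‖ ≤ (N * C + ε * ‖b‖) / c :=
    seqC0_norm_le (by positivity) fun m => by
      rw [le_div_iff₀ hc, mul_comm]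
      exact key m
  rw [le_div_iff₀ hc] at h6
  have h7 : N * C ≤ N * (C + 1) := by gcongr; linarith
  rw [div_mul_eq_mul_div, div_le_iff₀ (by positivity)]
  linarith

theorem not_isCompactOperator_of_separated (T : X →L[ℂ] Y) {x : ℕ → X} {C δ : ℝ}
    (hx : ∀ n, ‖x n‖ ≤ C) (hδ : 0 < δ) (hs : ∀ m n, m ≠ n → δ ≤ ‖T (x m) - T (x n)‖) :
    ¬ IsCompactOperator T := by
  intro hT
  obtain ⟨K, hK, hsub⟩ := hT.image_closedBall_subset_compact (f := (T : X →ₗ[ℂ] Y)) C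
  obtain ⟨y, -, φ, hφ, hlim⟩ := hK.tendsto_subseq (x := fun n => T (x n))
    fun n => hsub ⟨x n, by simpa using hx n, rfl⟩
  obtain ⟨N, hN⟩ := Metric.cauchySeq_iff.1 hlim.cauchySeq δ hδ
  have h1 := hN N le_rfl (N + 1) (Nat.le_succ N)
  rw [dist_eq_norm] at h1
  exact absurd (hs _ _ (hφ.injective.ne (Nat.lt_succ_self N).ne)) (not_le.2 h1)

/-- Half of Schauder's theorem. If `T` is compact, the image of the unit ball has a finite net;
bounded functionals restricted to the net lie in a compact polydisc, so a subsequence is Cauchy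
there, and two of its terms become close on the whole image. -/
theorem not_isCompactOperator_of_separated_dualMap (T : X →L[ℂ] Y) {x : ℕ → StrongDual ℂ Y}
    {C δ : ℝ} (hx : ∀ n, ‖x n‖ ≤ C) (hδ : 0 < δ)
    (hs : ∀ m n, m ≠ n → δ ≤ ‖dualMap T (x m) - dualMap T (x n)‖) :
    ¬ IsCompactOperator T := by
  intro hT
  have hC : 0 ≤ C := (norm_nonneg _).trans (hx 0)
  obtain ⟨K, hK, hsub⟩ := hT.image_closedBall_subset_compact (f := (T : X →ₗ[ℂ] Y)) 1
  -- Passing to the net costs `2 C η ≤ δ / 2`; with `δ / 4` on the net the total is `3 δ / 4 < δ`.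
  set η := δ / (4 * (C + 1)) with hη
  have hη0 : 0 < η := by positivity
  obtain ⟨t, -, htf, ht⟩ := hK.finite_cover_balls hη0
  have : Fintype t := htf.fintype
  obtain ⟨v, -, φ, hφ, hlim⟩ := (isCompact_univ_pi fun y : t =>
      isCompact_closedBall (0 : ℂ) (C * ‖(y : Y)‖)).tendsto_subseq (x := fun n (y : t) => x n y)
    fun n y _ => by
      simpa using ((x n).le_opNorm y).trans (by gcongr; exact hx n)
  obtain ⟨N, hN⟩ := Metric.cauchySeq_iff.1 hlim.cauchySeq (δ / 4) (by positivity)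
  have h1 := hN N le_rfl (N + 1) (Nat.le_succ N)
  rw [dist_pi_lt_iff (by positivity)] at h1
  refine absurd (hs _ _ (hφ.injective.ne (Nat.lt_succ_self N).ne)) (not_le.2 ?_)
  set u := x (φ N)
  set w := x (φ (N + 1))
  have h2 : ‖dualMap T u - dualMap T w‖ ≤ 3 * δ / 4 := by
    refine ContinuousLinearMap.opNorm_le_of_unit_norm (by positivity) fun z hz => ?_
    have hz' : T z ∈ K := hsub ⟨z, by simp [hz], rfl⟩
    obtain ⟨y, hy, hzy⟩ := mem_iUnion₂.1 (ht hz')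
    have h3 := h1 ⟨y, hy⟩
    simp only [Function.comp, dist_eq_norm] at h3
    have e : (dualMap T u - dualMap T w) z = (u y - w y) + (u - w) (T z - y) := by
      simp [dualMap]
      ring
    have h4 : ‖(u - w) (T z - y)‖ ≤ (C + C) * η := by
      refine ((u - w).le_opNorm _).trans ?_
      gcongr
      · exact (norm_sub_le _ _).trans (add_le_add (hx _) (hx _))
      · exact (mem_ball_iff_norm.1 hzy).le
    have h5 : (C + C) * η ≤ δ / 2 := by
      rw [hη, mul_div_assoc', div_le_div_iff₀ (by positivity) (by positivity)]
      nlinarith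
    rw [e]
    refine (norm_add_le _ _).trans ?_
    change ‖u y - w y‖ < δ / 4 at h3
    linarith
  linarith

theorem FixesCopy.exists_separated {T : X →L[ℂ] Y} (h : FixesCopy E T) {e : ℕ → E} {C δ : ℝ}
    (he : ∀ n, ‖e n‖ ≤ C) (hδ : 0 < δ) (hs : ∀ m n, m ≠ n → δ ≤ ‖e m - e n‖) :
    ∃ (x : ℕ → X) (C' δ' : ℝ), (∀ n, ‖x n‖ ≤ C') ∧ 0 < δ' ∧
      ∀ m n, m ≠ n → δ' ≤ ‖T (x m) - T (x n)‖ := by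
  obtain ⟨M, -, ⟨Φ⟩, c, hc, hM⟩ := h
  set A := (Φ : M →L[ℂ] E)
  set B := (Φ.symm : E →L[ℂ] M)
  refine ⟨fun n => (Φ.symm (e n) : M), ‖B‖ * C, c * (δ / (‖A‖ + 1)), fun n => ?_,
    by positivity, fun m n hmn => ?_⟩
  · exact (B.le_opNorm (e n)).trans (by gcongr; exact he n)
  · have h1 := hM _ (Φ.symm (e m) - Φ.symm (e n)).2
    rw [← map_sub T]
    refine le_trans ?_ h1
    gcongr
    rw [div_le_iff₀ (by positivity)]
    refine (hs m n hmn).trans ?_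
    have h2 := A.le_opNorm (Φ.symm (e m) - Φ.symm (e n))
    have h3 : A (Φ.symm (e m) - Φ.symm (e n)) = e m - e n := by simp [A]
    rw [h3] at h2
    refine h2.trans ?_
    rw [mul_comm]
    gcongr
    · simp
    · linarith

theorem not_isCompactOperator_of_fixesCopy_seqL1 {T : X →L[ℂ] Y} (h : FixesCopy SeqL1 T) :
    ¬ IsCompactOperator T := by
  classical
  obtain ⟨x, C, δ, h1, h2, h3⟩ := h.exists_separated (C := 1) (δ := 1)
    (e := fun n => lp.single 1 n (1 : ℂ)) (fun n => by rw [lp.norm_single (by simp)]; simp)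
    one_pos fun m n hmn => by
      have := lp.norm_apply_le_norm (p := 1) (by simp)
        (lp.single (E := fun _ : ℕ => ℂ) 1 m (1 : ℂ) - lp.single 1 n (1 : ℂ)) m
      simpa [lp.single_apply_ne, hmn, Pi.single_apply] using this
  exact not_isCompactOperator_of_separated T h1 h2 h3

theorem not_isCompactOperator_of_fixesCopy_seqC0 {T : X →L[ℂ] Y}
    (h : FixesCopy SeqC0 (dualMap T)) : ¬ IsCompactOperator T := by
  classical
  let e : ℕ → SeqC0 := fun n =>
    { toFun := fun k => if k = n then 1 else 0
      continuous_toFun := continuous_of_discreteTopology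
      zero_at_infty' := by
        refine tendsto_const_nhds.congr' ?_
        rw [Filter.cocompact_eq_cofinite]
        filter_upwards [(finite_singleton n).compl_mem_cofinite] with k hk
        simp at hk
        simp [hk] }
  have he : ∀ n k, e n k = if k = n then 1 else 0 := fun n k => rfl
  obtain ⟨x, C, δ, h1, h2, h3⟩ := h.exists_separated (C := 1) (δ := 1)
    (e := e) (fun n => seqC0_norm_le zero_le_one fun k => by rw [he]; split_ifs <;> simp)
    one_pos fun m n hmn => by
      have := seqC0_norm_apply_le (e m - e n) m
      simpa [he, hmn] using this
  exact not_isCompactOperator_of_separated_dualMap T h1 h2 h3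

end FixedCopies

/-! ### Gliding hump: extraction of almost disjointly supported functions -/

section AlmostDisjoint

/-- The sets `B n = {u n > η}` carry all but `ε / 2` of `u n`, and their measures tend to `0` by
almost everywhere convergence. By absolute continuity each fixed `u j` has small integral on late `B
n`; along a sparse subsequence one can remove from each set all the later ones at a total cost of `ε
/ 2`. -/
theorem exists_almost_disjoint {α : Type*} [MeasurableSpace α] {μ : Measure α} [IsFiniteMeasure μ]
    {u : ℕ → α → ℝ≥0∞} (hm : ∀ n, Measurable (u n)) (hfin : ∀ n, ∫⁻ x, u n x ∂μ ≠ ∞)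
    (hlim : ∀ᵐ x ∂μ, Filter.Tendsto (fun n => u n x) Filter.atTop (𝓝 0))
    {ε : ℝ≥0∞} (hε : ε ≠ 0) :
    ∃ (φ : ℕ → ℕ) (A : ℕ → Set α), StrictMono φ ∧ (∀ k, MeasurableSet (A k)) ∧
      Pairwise (Function.onFun Disjoint A) ∧ ∀ k, ∫⁻ x in (A k)ᶜ, u (φ k) x ∂μ ≤ ε := by
  have hε2 : ε / 2 ≠ 0 := by simpa using hε
  obtain ⟨η, hη, hημ⟩ := ENNReal.exists_nnreal_pos_mul_lt (measure_ne_top μ univ) hε2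
  set B : ℕ → Set α := fun n => {x | (η : ℝ≥0∞) < u n x} with hB
  have hBm : ∀ n, MeasurableSet (B n) := fun n => measurableSet_lt measurable_const (hm n)
  have hBc : ∀ n, ∫⁻ x in (B n)ᶜ, u n x ∂μ ≤ ε / 2 := fun n => by
    calc ∫⁻ x in (B n)ᶜ, u n x ∂μ ≤ ∫⁻ _ in (B n)ᶜ, η ∂μ :=
          setLIntegral_mono measurable_const fun x hx => not_lt.1 hx
      _ = η * μ (B n)ᶜ := setLIntegral_const _ _
      _ ≤ η * μ univ := by gcongr; exact subset_univ _
      _ ≤ ε / 2 := hημ.le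
  have hμB : Filter.Tendsto (fun n => μ (B n)) Filter.atTop (𝓝 0) := by
    have := tendsto_measure_of_ae_tendsto_indicator_of_isFiniteMeasure (μ := μ) Filter.atTop
      (A := ∅) MeasurableSet.empty hBm (by
        filter_upwards [hlim] with x hx
        filter_upwards [hx.eventually_lt_const (ENNReal.coe_pos.2 hη)] with n hn
        simpa [hB] using hn.le)
    simpa using this
  obtain ⟨δ, hδ, hδsum⟩ := ENNReal.exists_pos_sum_of_countable' hε2 ℕ
  have hev : ∀ k, ∃ N, ∀ n ≥ N, ∀ j ≤ k, ∫⁻ x in B n, u j x ∂μ ≤ δ k := fun k => by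
    rw [← Filter.eventually_atTop]
    refine (Set.finite_Iic k).eventually_all.2 fun j _ => ?_
    exact (tendsto_setLIntegral_zero (hfin j) hμB).eventually_le_const (hδ k)
  choose N hN using hev
  -- Each index exceeds `N` of the previous one, so on `B (φ (k + 1))` every `u j` with `j ≤ φ k`
  -- has integral at most `δ (φ k)`.
  let φ : ℕ → ℕ := fun k => Nat.rec 0 (fun _ m => max (m + 1) (N m)) k
  have hφs : ∀ k, φ (k + 1) = max (φ k + 1) (N (φ k)) := fun k => rfl
  have hφ : StrictMono φ := strictMono_nat_of_lt_succ fun k => by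
    rw [hφs]
    exact lt_of_lt_of_le (Nat.lt_succ_self _) (le_max_left _ _)
  have hφu : ∀ k l, ∫⁻ x in B (φ (k + l + 1)), u (φ k) x ∂μ ≤ δ (φ (k + l)) := fun k l =>
    hN (φ (k + l)) _ (by rw [hφs]; exact le_max_right _ _) _ (hφ.monotone (Nat.le_add_right k l))
  refine ⟨φ, fun k => B (φ k) \ ⋃ l, B (φ (k + l + 1)), hφ,
    fun k => (hBm _).diff (MeasurableSet.iUnion fun l => hBm _), ?_, fun k => ?_⟩
  · have hlt : ∀ i j, i < j → Disjoint (B (φ i) \ ⋃ l, B (φ (i + l + 1)))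
        (B (φ j) \ ⋃ l, B (φ (j + l + 1))) := fun i j hij => by
      refine Set.disjoint_left.2 fun x hx hx' => hx.2 ?_
      obtain ⟨l, rfl⟩ := Nat.exists_eq_add_of_lt hij
      exact mem_iUnion.2 ⟨l, hx'.1⟩
    intro i j hij
    rcases lt_or_gt_of_ne hij with h | h
    · exact hlt i j h
    · exact (hlt j i h).symm
  · have hsub : (B (φ k) \ ⋃ l, B (φ (k + l + 1)))ᶜ ⊆ (B (φ k))ᶜ ∪ ⋃ l, B (φ (k + l + 1)) := by
      intro x hx
      by_cases h : x ∈ B (φ k)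
      · exact Or.inr (by_contra fun h' => hx ⟨h, h'⟩)
      · exact Or.inl h
    calc _ ≤ ∫⁻ x in (B (φ k))ᶜ ∪ ⋃ l, B (φ (k + l + 1)), u (φ k) x ∂μ := lintegral_mono_set hsub
      _ ≤ ∫⁻ x in (B (φ k))ᶜ, u (φ k) x ∂μ + ∫⁻ x in ⋃ l, B (φ (k + l + 1)), u (φ k) x ∂μ :=
          lintegral_union_le _ _ _
      _ ≤ ε / 2 + ∑' l, δ (φ (k + l)) := by
          gcongr
          · exact hBc _
          · exact (lintegral_iUnion_le _ _).trans (ENNReal.tsum_le_tsum fun l => hφu k l)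
      _ ≤ ε / 2 + ε / 2 := by
          gcongr
          refine le_trans ?_ hδsum.le
          exact ENNReal.tsum_comp_le_tsum_of_injective
            (hφ.injective.comp (add_right_injective k)) δ
      _ = ε := ENNReal.add_halves ε

end AlmostDisjoint

/-! ### Hardy's inequality on a radius -/

section Hardy

theorem lintegral_rpow_le {α : Type*} [MeasurableSpace α] {ν : Measure α} {p : ℝ} (hp : 1 ≤ p)
    {ψ : α → ℝ≥0∞} (hψ : Measurable ψ) :
    (∫⁻ x, ψ x ∂ν) ^ p ≤ (ν univ) ^ (p - 1) * ∫⁻ x, ψ x ^ p ∂ν := by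
  have hp0 : 0 < p := by linarith
  rcases hp.eq_or_lt with rfl | hp1
  · simp
  have hpq : p.HolderConjugate (p / (p - 1)) := Real.HolderConjugate.conjExponent hp1
  have h := ENNReal.lintegral_mul_le_Lp_mul_Lq ν hpq hψ.aemeasurable
    (measurable_const (a := (1 : ℝ≥0∞))).aemeasurable
  simp only [Pi.mul_apply, mul_one, ENNReal.one_rpow, lintegral_one] at h
  calc (∫⁻ x, ψ x ∂ν) ^ p
      ≤ ((∫⁻ x, ψ x ^ p ∂ν) ^ (1 / p) * ν univ ^ (1 / (p / (p - 1)))) ^ p := by gcongr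
    _ = _ := by
      rw [ENNReal.mul_rpow_of_nonneg _ _ hp0.le, ← ENNReal.rpow_mul, ← ENNReal.rpow_mul,
        one_div_mul_cancel hp0.ne', ENNReal.rpow_one, mul_comm]
      congr 2
      field_simp

theorem lintegral_Ioc_one_sub_rpow_le {b r : ℝ} (hb : 0 < b) (hr : 0 ≤ r) (hr1 : r < 1) :
    ∫⁻ s in Ioc 0 r, ENNReal.ofReal ((1 - s) ^ (-1 - b)) ≤ ENNReal.ofReal ((1 - r) ^ (-b) / b) := by
  have hi : IntervalIntegrable (fun s : ℝ => (1 - s) ^ (-1 - b)) volume 0 r := by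
    refine ContinuousOn.intervalIntegrable fun s hs => ContinuousAt.continuousWithinAt ?_
    rw [uIcc_of_le hr] at hs
    exact ContinuousAt.rpow_const (by fun_prop) (Or.inl (by linarith [hs.2]))
  rw [intervalIntegrable_iff_integrableOn_Ioc_of_le hr] at hi
  rw [← ofReal_integral_eq_lintegral_ofReal hi]
  · apply ENNReal.ofReal_le_ofReal
    rw [← intervalIntegral.integral_of_le hr,
      intervalIntegral.integral_comp_sub_left (fun x : ℝ => x ^ (-1 - b)) 1, sub_zero,
      integral_rpow (Or.inr ⟨by linarith, by
        rw [uIcc_of_le (by linarith)]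
        intro h
        linarith [h.1]⟩)]
    have : -1 - b + 1 = -b := by ring
    rw [this, Real.one_rpow, div_neg, ← neg_div]
    gcongr
    linarith
  · refine (ae_restrict_mem measurableSet_Ioc).mono fun s hs => ?_
    exact Real.rpow_nonneg (by linarith [hs.2]) _

theorem lintegral_Ico_one_sub_rpow {c s : ℝ} (hc : c < 1) (hs1 : s ≤ 1) :
    ∫⁻ r in Ico s 1, ENNReal.ofReal ((1 - r) ^ (-c)) =
      ENNReal.ofReal ((1 - s) ^ (1 - c) / (1 - c)) := by
  have hi : IntervalIntegrable (fun r : ℝ => (1 - r) ^ (-c)) volume s 1 := by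
    have := (intervalIntegral.intervalIntegrable_rpow' (a := 0) (b := 1 - s) (r := -c)
      (by linarith)).comp_sub_left 1
    simpa using this.symm
  rw [intervalIntegrable_iff_integrableOn_Ioc_of_le hs1] at hi
  rw [setLIntegral_congr Ico_ae_eq_Ioc, ← ofReal_integral_eq_lintegral_ofReal hi]
  · rw [← intervalIntegral.integral_of_le hs1,
      intervalIntegral.integral_comp_sub_left (fun x : ℝ => x ^ (-c)) 1, sub_self,
      integral_rpow (Or.inl (by linarith)), Real.zero_rpow (by linarith), sub_zero]
    congr 2 <;> ring_nf
  · refine (ae_restrict_mem measurableSet_Ioc).mono fun r hr => ?_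
    exact Real.rpow_nonneg (by linarith [hr.2]) _

/-- A Schur-type argument: split `(1 - s)⁻¹ = (1 - s)^(-1 - b) * (1 - s)^b`, apply Hölder against
the measure with density `(1 - s)^(-1 - b)`, whose mass on `(0, r]` is at most `(1 - r)^(-b) / b`,
and exchange the integrals. All powers of `1 - s` then cancel. -/
theorem hardy_inequality {p : ℝ} (hp : 1 ≤ p) : ∃ C : ℝ≥0∞, C ≠ ∞ ∧ ∀ φ : ℝ → ℝ≥0∞, Measurable φ →
    ∫⁻ r in Ico (0 : ℝ) 1, (∫⁻ s in Ioc 0 r, φ s * ENNReal.ofReal (1 - s)⁻¹) ^ p ≤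
      C * ∫⁻ r in Ico (0 : ℝ) 1, φ r ^ p := by
  have hp0 : 0 < p := by linarith
  -- What matters is `0 < b` and `b * (p - 1) < 1`, which makes the outer integral of `(1 - r)^(-b
  -- (p - 1))` converge.
  set b : ℝ := 1 / (2 * p) with hb
  have hb0 : 0 < b := by positivity
  have hbp : b * p = 1 / 2 := by rw [hb]; field_simp
  have hc : b * (p - 1) < 1 := by nlinarith
  set D : ℝ := (1 / b) ^ (p - 1) / (1 - b * (p - 1)) with hD
  have hD0 : 0 ≤ D := div_nonneg (Real.rpow_nonneg (by positivity) _) (by linarith)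
  refine ⟨ENNReal.ofReal D, ENNReal.ofReal_ne_top, fun φ hφ => ?_⟩
  set w : ℝ → ℝ≥0∞ := fun s => ENNReal.ofReal ((1 - s) ^ (-1 - b)) with hw
  set ψ : ℝ → ℝ≥0∞ := fun s => φ s * ENNReal.ofReal ((1 - s) ^ b) with hψ
  set A : ℝ → ℝ≥0∞ := fun r => ENNReal.ofReal ((1 / b) ^ (p - 1)) *
    ENNReal.ofReal ((1 - r) ^ (-(b * (p - 1)))) with hA
  have hwm : Measurable w := by fun_prop
  have hψm : Measurable ψ := by fun_prop
  have hAm : Measurable A := by fun_prop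
  have h1 : ∀ r ∈ Ico (0 : ℝ) 1, (∫⁻ s in Ioc 0 r, φ s * ENNReal.ofReal (1 - s)⁻¹) ^ p ≤
      A r * ∫⁻ s in Ioc 0 r, w s * ψ s ^ p := fun r hr => by
    have e1 : ∫⁻ s in Ioc 0 r, φ s * ENNReal.ofReal (1 - s)⁻¹ =
        ∫⁻ s, ψ s ∂((volume.restrict (Ioc 0 r)).withDensity w) := by
      rw [lintegral_withDensity_eq_lintegral_mul _ hwm hψm]
      refine setLIntegral_congr_fun measurableSet_Ioc fun s hs => ?_
      have hs' : 0 < 1 - s := by linarith [hs.2, hr.2]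
      simp only [hw, hψ, Pi.mul_apply]
      rw [mul_left_comm, ← ENNReal.ofReal_mul (by positivity), ← Real.rpow_add hs']
      congr 2
      rw [← Real.rpow_neg_one]
      congr 1
      ring
    rw [e1]
    refine (lintegral_rpow_le hp hψm).trans ?_
    rw [lintegral_withDensity_eq_lintegral_mul _ hwm (hψm.pow_const p)]
    gcongr
    · rw [withDensity_apply _ MeasurableSet.univ, Measure.restrict_univ]
      have hr' : 0 < 1 - r := by linarith [hr.2]
      calc _ ≤ (ENNReal.ofReal ((1 - r) ^ (-b) / b)) ^ (p - 1) := by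
            gcongr
            exact lintegral_Ioc_one_sub_rpow_le hb0 hr.1 hr.2
        _ = A r := by
            rw [ENNReal.ofReal_rpow_of_nonneg (by positivity) (by linarith), hA]
            simp only
            rw [← ENNReal.ofReal_mul (by positivity), div_eq_mul_one_div,
              Real.mul_rpow (by positivity) (by positivity), ← Real.rpow_mul hr'.le, mul_comm]
            congr 3
            ring
    · exact le_rfl
  calc _ ≤ ∫⁻ r in Ico (0 : ℝ) 1, A r * ∫⁻ s in Ioc 0 r, w s * ψ s ^ p :=
        setLIntegral_mono' measurableSet_Ico h1
    _ = ∫⁻ r in Ico (0 : ℝ) 1, ∫⁻ s in Ico (0 : ℝ) 1,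
          {x : ℝ × ℝ | 0 < x.2 ∧ x.2 ≤ x.1}.indicator (fun x => A x.1 * (w x.2 * ψ x.2 ^ p)) (r, s) := by
        refine setLIntegral_congr_fun measurableSet_Ico fun r hr => ?_
        rw [← lintegral_const_mul _ (by fun_prop), ← lintegral_indicator measurableSet_Ioc,
          ← lintegral_indicator measurableSet_Ico]
        congr 1
        ext s
        by_cases h : 0 < s ∧ s ≤ r
        · have h2 : s ∈ Ico (0 : ℝ) 1 := ⟨h.1.le, h.2.trans_lt hr.2⟩
          have h3 : s ∈ Ioc 0 r := h
          simp [indicator, h, h2, h3, -mem_Ico]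
        · have h3 : s ∉ Ioc 0 r := h
          simp [indicator, h, h3]
    _ = ∫⁻ s in Ico (0 : ℝ) 1, ∫⁻ r in Ico (0 : ℝ) 1,
          {x : ℝ × ℝ | 0 < x.2 ∧ x.2 ≤ x.1}.indicator (fun x => A x.1 * (w x.2 * ψ x.2 ^ p)) (r, s) := by
        refine lintegral_lintegral_swap (Measurable.aemeasurable ?_)
        refine Measurable.indicator (by fun_prop) ?_
        exact (measurableSet_lt measurable_const measurable_snd).inter
          (measurableSet_le measurable_snd measurable_fst)
    _ ≤ ∫⁻ s in Ico (0 : ℝ) 1, ENNReal.ofReal D * φ s ^ p := by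
        refine setLIntegral_mono' measurableSet_Ico fun s hs => ?_
        have hs' : 0 < 1 - s := by linarith [hs.2]
        calc _ ≤ ∫⁻ r in Ico s 1, A r * (w s * ψ s ^ p) := by
              rw [← lintegral_indicator measurableSet_Ico, ← lintegral_indicator measurableSet_Ico]
              refine lintegral_mono fun r => ?_
              by_cases h : s ≤ r
              · by_cases h' : r < 1
                · have h2 : r ∈ Ico s 1 := ⟨h, h'⟩
                  have h3 : r ∈ Ico 0 1 := ⟨hs.1.trans h, h'⟩
                  simp only [indicator_of_mem h2, indicator_of_mem h3]
                  exact indicator_le_self _ _ _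
                · simp [indicator, h']
              · simp [indicator, h]
          _ = (∫⁻ r in Ico s 1, A r) * (w s * ψ s ^ p) := lintegral_mul_const _ hAm
          _ = ENNReal.ofReal ((1 / b) ^ (p - 1)) * ENNReal.ofReal ((1 - s) ^ (1 - b * (p - 1)) /
                (1 - b * (p - 1))) * (w s * ψ s ^ p) := by
              rw [lintegral_const_mul _ (by fun_prop), lintegral_Ico_one_sub_rpow hc hs.2.le]
          _ = ENNReal.ofReal D * φ s ^ p := by
              simp only [hw, hψ, ENNReal.mul_rpow_of_nonneg _ _ hp0.le]
              rw [ENNReal.ofReal_rpow_of_nonneg (by positivity) hp0.le]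
              rw [← ENNReal.ofReal_mul (by positivity), mul_left_comm (ENNReal.ofReal _) (φ s ^ p),
                ← ENNReal.ofReal_mul (by positivity), mul_left_comm, mul_comm (ENNReal.ofReal D),
                ← ENNReal.ofReal_mul (by
                  refine mul_nonneg (by positivity) (div_nonneg (by positivity) (by linarith)))]
              congr 2
              rw [hD, ← Real.rpow_mul hs'.le, ← Real.rpow_add hs', mul_div_assoc', div_mul_eq_mul_div,
                mul_assoc, ← Real.rpow_add hs']
              have : 1 - b * (p - 1) + (-1 - b + b * p) = 0 := by ring
              rw [this, Real.rpow_zero, mul_one]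
    _ = _ := lintegral_const_mul _ (hφ.pow_const p)

end Hardy

/-! ### Bounds for Taylor coefficients, values and derivatives -/

section PointEvaluations

theorem rho_one (p : ℝ) (f : ℂ → ℂ) : rho p 1 f = (ENNReal.ofReal (2 * Real.pi))⁻¹ *
    ∫⁻ t in Ioc (0 : ℝ) (2 * Real.pi), radialMean p f t := by
  simp [rho]

theorem polar_mem_ball {r : ℝ} (hr : r ∈ Ico (0 : ℝ) 1) (t : ℝ) :
    (r * Complex.exp (t * Complex.I) : ℂ) ∈ ball (0 : ℂ) 1 := by
  simp [abs_of_nonneg hr.1, hr.2]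

theorem norm_polar {r : ℝ} (hr : 0 ≤ r) (t : ℝ) :
    ‖(r * Complex.exp (t * Complex.I) : ℂ)‖ = r := by
  simp [abs_of_nonneg hr]

/-- The mean of `|f|` over the circle of radius `r`. -/
def circleMean (f : ℂ → ℂ) (r : ℝ) : ℝ≥0∞ :=
  (ENNReal.ofReal (2 * Real.pi))⁻¹ *
    ∫⁻ t in Ioc (0 : ℝ) (2 * Real.pi), ‖f (r * Complex.exp (t * Complex.I))‖ₑ

theorem ofReal_circle_integral {f : ℂ → ℂ} (hf : IsHolo f) {r : ℝ} (hr : r ∈ Ico (0 : ℝ) 1) :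
    ENNReal.ofReal ((2 * Real.pi)⁻¹ * ∫ θ in 0..2 * Real.pi, ‖f (circleMap 0 r θ)‖) =
      circleMean f r := by
  have hpi : (0 : ℝ) ≤ 2 * Real.pi := by positivity
  have hc : Continuous fun θ : ℝ => f (circleMap 0 r θ) := by
    refine hf.1.continuousOn.comp_continuous (continuous_circleMap 0 r) fun θ => ?_
    simp [circleMap, abs_of_nonneg hr.1, hr.2]
  rw [ENNReal.ofReal_mul (by positivity), ENNReal.ofReal_inv_of_pos (by positivity),
    intervalIntegral.integral_of_le hpi, ofReal_integral_norm_eq_lintegral_enorm]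
  · simp [circleMean, circleMap]
  · exact (hc.integrableOn_Icc).mono_set Ioc_subset_Icc_self

theorem lintegral_radial_le {p : ℝ} (hp : 1 ≤ p) {f : ℂ → ℂ} (hf : Measurable f) {a : ℝ}
    (ha : 0 ≤ a) (t : ℝ) :
    ∫⁻ r in Ico a 1, ‖f (r * Complex.exp (t * Complex.I))‖ₑ ≤
      ENNReal.ofReal (1 - a) ^ (1 - 1 / p) * radialMean p f t := by
  have hp0 : 0 < p := by linarith
  have h := lintegral_rpow_le (ν := volume.restrict (Ico a 1)) hp (measurable_ray hf t).enorm
  rw [Measure.restrict_apply_univ, Real.volume_Ico] at h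
  have h2 : ∫⁻ r in Ico a 1, ‖f (r * Complex.exp (t * Complex.I))‖ₑ ^ p ≤
      ∫⁻ r in Ico (0 : ℝ) 1, ‖f (r * Complex.exp (t * Complex.I))‖ₑ ^ p :=
    lintegral_mono_set (Ico_subset_Ico_left ha)
  have h3 := ENNReal.rpow_le_rpow (h.trans (mul_le_mul_right h2 _))
    (show (0 : ℝ) ≤ 1 / p by positivity)
  rw [← ENNReal.rpow_mul, mul_one_div_cancel hp0.ne', ENNReal.rpow_one,
    ENNReal.mul_rpow_of_nonneg _ _ (by positivity), ← ENNReal.rpow_mul] at h3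
  have e : (p - 1) * (1 / p) = 1 - 1 / p := by field_simp
  rwa [e] at h3

/-- Tonelli and Hölder in the radius. The power of `1 - a` is what later gives the right growth
exponent for derivatives. -/
theorem lintegral_circleMean_le {p : ℝ} (hp : 1 ≤ p) {f : ℂ → ℂ} (hf : Measurable f) {a : ℝ}
    (ha : 0 ≤ a) :
    ∫⁻ r in Ico a 1, circleMean f r ≤ ENNReal.ofReal (1 - a) ^ (1 - 1 / p) * rho p 1 f := by
  have hm : Measurable (Function.uncurry fun (r t : ℝ) =>
      ‖f (r * Complex.exp (t * Complex.I))‖ₑ) :=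
    ((measurable_polar hf).comp measurable_swap).enorm
  unfold circleMean
  rw [lintegral_const_mul' _ _ (by simp [Real.pi_pos]), lintegral_lintegral_swap hm.aemeasurable,
    rho_one, mul_left_comm]
  gcongr
  rw [← lintegral_const_mul _ (measurable_radialMean hf p)]
  exact lintegral_mono fun t => lintegral_radial_le hp hf ha t

/-- The Taylor coefficient of `f` at `0`. -/
def coeff (n : ℕ) (f : ℂ → ℂ) : ℂ := ((n.factorial : ℕ) : ℂ)⁻¹ * iteratedDeriv n f 0

theorem hasSum_coeff {f : ℂ → ℂ} (hf : IsHolo f) {z : ℂ} (hz : z ∈ ball (0 : ℂ) 1) :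
    HasSum (fun n => coeff n f * z ^ n) (f z) := by
  refine (Complex.hasSum_taylorSeries_on_ball hf.1 hz).congr_fun fun n => ?_
  simp only [coeff, sub_zero, smul_eq_mul]
  ring

theorem enorm_coeff_mul_pow_le {f : ℂ → ℂ} (hf : IsHolo f) {r : ℝ} (hr : r ∈ Ioo (0 : ℝ) 1)
    (n : ℕ) : ‖coeff n f‖ₑ * ENNReal.ofReal (r ^ n) ≤ circleMean f r := by
  have hr0 : 0 < r := hr.1
  set R : NNReal := ⟨r, hr0.le⟩
  have H : HasFPowerSeriesOnBall f (cauchyPowerSeries f 0 R) 0 R :=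
    (hf.1.mono (closedBall_subset_ball (show (R : ℝ) < 1 from hr.2))).hasFPowerSeriesOnBall
      (show 0 < R from hr0)
  have h1 : coeff n f = (cauchyPowerSeries f 0 R n) fun _ => 1 := by
    have := H.factorial_smul (1 : ℂ) n
    rw [coeff, iteratedDeriv_eq_iteratedFDeriv, ← this]
    have hn : (n.factorial : ℂ) ≠ 0 := by exact_mod_cast n.factorial_ne_zero
    simp [hn]
  have h2 : ‖coeff n f‖ * r ^ n ≤
      (2 * Real.pi)⁻¹ * ∫ θ in 0..2 * Real.pi, ‖f (circleMap 0 r θ)‖ := by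
    have h3 : ‖coeff n f‖ ≤ ‖cauchyPowerSeries f 0 R n‖ := by
      rw [h1]
      simp
    have h4 := h3.trans (norm_cauchyPowerSeries_le f 0 R n)
    have hR : (R : ℝ) = r := rfl
    rw [hR, abs_of_pos hr0] at h4
    rwa [inv_pow, ← div_eq_mul_inv, le_div_iff₀ (by positivity)] at h4
  rw [← ofReal_circle_integral hf ⟨hr0.le, hr.2⟩, ← ofReal_norm, ← ENNReal.ofReal_mul (norm_nonneg _)]
  exact ENNReal.ofReal_le_ofReal h2

variable {p : ℝ} [hp : Fact (1 ≤ p)]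

/-- A holomorphic function with finite mean, as an element of `RM(p,q)`. -/
def RM.mk {q : ℝ} [Fact (1 ≤ q)] (f : ℂ → ℂ) (hf : IsHolo f) (h : rho p q f < ∞) : RM p q :=
  ⟨f, hf, h⟩

@[simp] theorem RM.coe_sub {q : ℝ} [Fact (1 ≤ q)] (f g : RM p q) :
    ((f - g : RM p q) : ℂ → ℂ) = f - g := rfl

theorem RM.ext {q : ℝ} [Fact (1 ≤ q)] {f g : RM p q} (h : (f : ℂ → ℂ) = g) : f = g :=
  Subtype.ext h

theorem RM.isHolo {q : ℝ} [Fact (1 ≤ q)] (f : RM p q) : IsHolo f := f.2.1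

theorem ofReal_norm_RM {q : ℝ} [Fact (1 ≤ q)] (f : RM p q) : ENNReal.ofReal ‖f‖ = rho p q f := by
  rw [norm_def, ENNReal.ofReal_toReal f.2.2.ne]

theorem lintegral_circleMean_RM_le (f : RM p 1) {a : ℝ} (ha : 0 ≤ a) (ha1 : a < 1) :
    ∫⁻ r in Ico a 1, circleMean f r ≤ ENNReal.ofReal ((1 - a) ^ (1 - 1 / p) * ‖f‖) := by
  have : 0 < 1 - a := by linarith
  rw [ENNReal.ofReal_mul (by positivity), ofReal_norm_RM, ← ENNReal.ofReal_rpow_of_pos this]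
  exact lintegral_circleMean_le hp.out f.isHolo.measurable ha

/-- Cauchy's estimate on each circle, integrated over the radius: the factor is the inverse of `∫₀¹
r^n dr`. -/
theorem norm_coeff_le (f : RM p 1) (n : ℕ) : ‖coeff n f‖ ≤ (n + 1) * ‖f‖ := by
  have h1 : ∫⁻ r in Ico (0 : ℝ) 1, ‖coeff n f‖ₑ * ENNReal.ofReal (r ^ n) ≤ ENNReal.ofReal ‖f‖ := by
    calc _ = ∫⁻ r in Ioo (0 : ℝ) 1, ‖coeff n f‖ₑ * ENNReal.ofReal (r ^ n) :=
          setLIntegral_congr Ioo_ae_eq_Ico.symm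
      _ ≤ ∫⁻ r in Ioo (0 : ℝ) 1, circleMean f r :=
          setLIntegral_mono' measurableSet_Ioo fun r hr => enorm_coeff_mul_pow_le f.isHolo hr n
      _ = ∫⁻ r in Ico (0 : ℝ) 1, circleMean f r := setLIntegral_congr Ioo_ae_eq_Ico
      _ ≤ _ := by simpa using lintegral_circleMean_RM_le f le_rfl one_pos
  have h2 : ∫⁻ r in Ico (0 : ℝ) 1, ENNReal.ofReal (r ^ n) = ENNReal.ofReal (1 / (n + 1)) := by
    have hi : IntervalIntegrable (fun r : ℝ => r ^ n) volume 0 1 :=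
      (continuous_pow n).intervalIntegrable 0 1
    rw [intervalIntegrable_iff_integrableOn_Ioc_of_le zero_le_one] at hi
    rw [setLIntegral_congr Ico_ae_eq_Ioc, ← ofReal_integral_eq_lintegral_ofReal hi,
      ← intervalIntegral.integral_of_le zero_le_one, integral_pow]
    · simp
    · exact (ae_restrict_mem measurableSet_Ioc).mono fun r hr => pow_nonneg hr.1.le n
  rw [lintegral_const_mul' _ _ enorm_ne_top, h2, ← ofReal_norm,
    ← ENNReal.ofReal_mul (norm_nonneg _), ENNReal.ofReal_le_ofReal_iff (norm_nonneg _)] at h1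
  rw [mul_one_div, div_le_iff₀ (by positivity)] at h1
  linarith

theorem summable_succ_mul_pow {x : ℝ} (hx : 0 ≤ x) (hx1 : x < 1) :
    Summable fun n : ℕ => ((n : ℝ) + 1) * x ^ n := by
  have h1 := summable_pow_mul_geometric_of_norm_lt_one 1 (r := x) (by rwa [Real.norm_of_nonneg hx])
  have h2 := summable_geometric_of_lt_one hx hx1
  simpa [add_mul] using h1.add h2

theorem norm_apply_le (f : RM p 1) {R : ℝ} (hR1 : R < 1) {z : ℂ} (hz : ‖z‖ ≤ R) :
    ‖f z‖ ≤ (∑' n : ℕ, ((n : ℝ) + 1) * R ^ n) * ‖f‖ := by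
  have hR : 0 ≤ R := (norm_nonneg z).trans hz
  have h := hasSum_coeff f.isHolo (z := z) (by simpa using hz.trans_lt hR1)
  rw [← h.tsum_eq]
  refine tsum_of_norm_bounded ((summable_succ_mul_pow hR hR1).hasSum.mul_right ‖f‖) fun n => ?_
  rw [norm_mul, norm_pow]
  calc ‖coeff n f‖ * ‖z‖ ^ n ≤ ((n + 1) * ‖f‖) * R ^ n := by
        gcongr
        exact norm_coeff_le f n
    _ = _ := by ring

theorem enorm_deriv_le {f : ℂ → ℂ} (hf : IsHolo f) {w : ℂ} {r : ℝ} (hr : r < 1) (hw : ‖w‖ < r) :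
    ‖deriv f w‖ₑ ≤ ENNReal.ofReal (((r - ‖w‖) ^ 2)⁻¹) * circleMean f r := by
  have hr0 : 0 < r := (norm_nonneg w).trans_lt hw
  have hk : 0 < r - ‖w‖ := by linarith
  rw [← ofReal_circle_integral hf ⟨hr0.le, hr⟩, ← ENNReal.ofReal_mul (by positivity), ← ofReal_norm]
  apply ENNReal.ofReal_le_ofReal
  rw [← Complex.two_pi_I_inv_smul_circleIntegral_sub_sq_inv_smul_of_differentiable isOpen_ball
    (closedBall_subset_ball hr) hf.1 (by simpa using hw : w ∈ ball (0 : ℂ) r)]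
  have hc : Continuous fun θ : ℝ => f (circleMap 0 r θ) := by
    refine hf.1.continuousOn.comp_continuous (continuous_circleMap 0 r) fun θ => ?_
    simp [circleMap, abs_of_nonneg hr0.le, hr]
  have hpi : (0 : ℝ) ≤ 2 * Real.pi := by positivity
  have hint : ‖∮ z in C(0, r), ((z - w) ^ 2)⁻¹ • f z‖ ≤
      ∫ θ in 0..2 * Real.pi, ((r - ‖w‖) ^ 2)⁻¹ * ‖f (circleMap 0 r θ)‖ := by
    unfold circleIntegral
    refine intervalIntegral.norm_integral_le_of_norm_le hpi (Filter.Eventually.of_forall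
      fun θ _ => ?_) ((continuous_const.mul hc.norm).intervalIntegrable _ _)
    have h1 : r - ‖w‖ ≤ ‖circleMap 0 r θ - w‖ := by
      have := norm_sub_norm_le (circleMap 0 r θ) w
      rwa [norm_circleMap_zero, abs_of_pos hr0] at this
    rw [deriv_circleMap, norm_smul, norm_smul, norm_mul, norm_circleMap_zero, Complex.norm_I,
      mul_one, abs_of_pos hr0, norm_inv, norm_pow]
    calc r * ((‖circleMap 0 r θ - w‖ ^ 2)⁻¹ * ‖f (circleMap 0 r θ)‖)
        ≤ 1 * (((r - ‖w‖) ^ 2)⁻¹ * ‖f (circleMap 0 r θ)‖) := by gcongr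
      _ = _ := one_mul _
  rw [intervalIntegral.integral_const_mul] at hint
  rw [norm_smul, norm_inv]
  calc _ ≤ ‖(2 * Real.pi * Complex.I : ℂ)‖⁻¹ *
        (((r - ‖w‖) ^ 2)⁻¹ * ∫ θ in 0..2 * Real.pi, ‖f (circleMap 0 r θ)‖) := by gcongr
    _ = _ := by
        simp only [norm_mul, Complex.norm_I, Complex.norm_real, Real.norm_of_nonneg Real.pi_pos.le,
          Complex.norm_ofNat, mul_one]
        ring

/-- Cauchy's formula for the derivative is averaged over radii in `[1 - d/2, 1)`, `d = 1 - |w|`. The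
kernel costs `(d/2)^(-2)`, the circle means `(d/2)^(1 - 1/p)`, and one divides by the length `d/2`;
then `2^(1/p) ≤ 2` gives the constant `8`. -/
theorem norm_deriv_le (f : RM p 1) {w : ℂ} (hw : ‖w‖ < 1) :
    ‖deriv f w‖ ≤ 8 * (1 - ‖w‖) ^ (-2 - 1 / p) * ‖f‖ := by
  have hp0 : 0 < p := by linarith [hp.out]
  set d := 1 - ‖w‖ with hd
  have hd0 : 0 < d := by linarith
  have hw0 := norm_nonneg w
  set a := 1 - d / 2 with ha
  have h1 : ∫⁻ r in Ico a 1, ‖deriv f w‖ₑ ≤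
      ENNReal.ofReal (((d / 2) ^ 2)⁻¹) * ENNReal.ofReal ((1 - a) ^ (1 - 1 / p) * ‖f‖) := by
    refine le_trans ?_ (mul_le_mul_right
      (lintegral_circleMean_RM_le f (a := a) (by linarith) (by linarith)) _)
    rw [← lintegral_const_mul' _ _ ENNReal.ofReal_ne_top]
    refine setLIntegral_mono' measurableSet_Ico fun r hr => ?_
    refine (enorm_deriv_le f.isHolo hr.2 (by linarith [hr.1])).trans ?_
    gcongr
    linarith [hr.1]
  have ha' : 1 - a = d / 2 := by rw [ha]; ring
  rw [setLIntegral_const, Real.volume_Ico, ha', ← ofReal_norm, ← ENNReal.ofReal_mul (norm_nonneg _),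
    ← ENNReal.ofReal_mul (by positivity), ENNReal.ofReal_le_ofReal_iff (by positivity)] at h1
  have h2 : (d / 2) ^ (1 - 1 / p) = (d / 2) * (d / 2) ^ (-(1 / p)) := by
    rw [sub_eq_add_neg, Real.rpow_add (by positivity), Real.rpow_one]
  have h3 : (d / 2) ^ (-(1 / p)) ≤ 2 * d ^ (-(1 / p)) := by
    rw [Real.div_rpow hd0.le zero_le_two, div_eq_mul_inv, ← Real.rpow_neg zero_le_two, neg_neg,
      mul_comm]
    gcongr
    calc (2 : ℝ) ^ (1 / p) ≤ 2 ^ (1 : ℝ) := by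
          gcongr
          · norm_num
          · rw [div_le_one hp0]; exact hp.out
      _ = 2 := Real.rpow_one 2
  have h4 : d ^ (-2 - 1 / p) = (d ^ 2)⁻¹ * d ^ (-(1 / p)) := by
    rw [sub_eq_add_neg, Real.rpow_add hd0, Real.rpow_neg hd0.le]
    norm_cast
  rw [h2] at h1
  have h5 : ‖deriv f w‖ ≤ ((d / 2) ^ 2)⁻¹ * ((d / 2) ^ (-(1 / p)) * ‖f‖) := by
    have : 0 < d / 2 := by positivity
    refine le_of_mul_le_mul_right ?_ this
    calc _ ≤ _ := h1
      _ = _ := by ring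
  rw [h4]
  calc _ ≤ _ := h5
    _ ≤ ((d / 2) ^ 2)⁻¹ * ((2 * d ^ (-(1 / p))) * ‖f‖) := by gcongr
    _ = _ := by field_simp; ring

end PointEvaluations

/-! ### Completeness of `RM(p,1)` -/

section Complete

/-- Fatou's lemma twice, in the radius and then in the angle. -/
theorem rho_le_of_tendsto {p : ℝ} (hp : 1 ≤ p) {h : ℕ → ℂ → ℂ} {f : ℂ → ℂ}
    (hm : ∀ n, Measurable (h n)) (hlim : ∀ z, Filter.Tendsto (fun n => h n z) Filter.atTop (𝓝 (f z)))
    {K : ℝ≥0∞} (hK : ∀ᶠ n in Filter.atTop, rho p 1 (h n) ≤ K) : rho p 1 f ≤ K := by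
  have hp0 : 0 < 1 / p := by positivity
  have h1 : ∀ t, radialMean p f t ≤ Filter.liminf (fun n => radialMean p (h n) t) Filter.atTop := by
    intro t
    unfold radialMean
    have e := (ENNReal.orderIsoRpow (1 / p) hp0).liminf_apply (f := Filter.atTop)
      (u := fun n => ∫⁻ r in Ico (0 : ℝ) 1, ‖h n (r * Complex.exp (t * Complex.I))‖ₑ ^ p)
    simp only [ENNReal.orderIsoRpow_apply] at e
    rw [← e]
    gcongr
    refine le_trans (lintegral_mono fun r => ?_)
      (lintegral_liminf_le fun n => (measurable_ray (hm n) t).enorm.pow_const p)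
    refine (Filter.Tendsto.liminf_eq ?_).ge
    exact (ENNReal.continuous_rpow_const.tendsto _).comp (hlim _).enorm
  calc rho p 1 f ≤ (ENNReal.ofReal (2 * Real.pi))⁻¹ *
        Filter.liminf (fun n => ∫⁻ t in Ioc (0 : ℝ) (2 * Real.pi), radialMean p (h n) t)
          Filter.atTop := by
        rw [rho_one]
        gcongr
        exact (lintegral_mono h1).trans
          (lintegral_liminf_le fun n => measurable_radialMean (hm n) p)
    _ = Filter.liminf (fun n => rho p 1 (h n)) Filter.atTop := by
        simp only [rho_one]
        have hne : (ENNReal.ofReal (2 * Real.pi))⁻¹ ≠ ∞ := by simp [Real.pi_pos]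
        exact (ENNReal.liminf_const_mul_of_ne_top hne).symm
    _ ≤ K := Filter.liminf_le_of_frequently_le' hK.frequently

variable {p : ℝ} [hp : Fact (1 ≤ p)]

/-- A Cauchy sequence converges uniformly on compact subsets of the disc by `norm_apply_le`, hence
to a holomorphic function, and Fatou turns this into norm convergence. Completeness is needed to sum
the series defining the embedding of `ℓ¹`. -/
instance : CompleteSpace (RM p 1) := by
  refine Metric.complete_of_cauchySeq_tendsto fun u hu => ?_
  have hsub : ∀ m n, ∀ z, (u m - u n : RM p 1) z = u m z - u n z := fun m n z => rfl
  have hc : ∀ z, ∃ y, Filter.Tendsto (fun n => u n z) Filter.atTop (𝓝 y) := by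
    intro z
    refine cauchySeq_tendsto_of_complete ?_
    by_cases hz : z ∈ ball (0 : ℂ) 1
    · have hz1 : ‖z‖ < 1 := by simpa using hz
      set K := ∑' n : ℕ, ((n : ℝ) + 1) * ‖z‖ ^ n
      have hL : LipschitzWith K.toNNReal fun f : RM p 1 => f z := by
        refine LipschitzWith.of_dist_le_mul fun f g => ?_
        rw [dist_eq_norm, dist_eq_norm,
          Real.coe_toNNReal _ (tsum_nonneg fun n => by positivity)]
        exact norm_apply_le (f - g) hz1 le_rfl
      exact hL.uniformContinuous.comp_cauchySeq hu
    · simp only [(u _).isHolo.2 z hz]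
      exact cauchySeq_const 0
  choose F hF using hc
  have hloc : TendstoLocallyUniformlyOn (fun n => (u n : ℂ → ℂ)) F Filter.atTop (ball 0 1) := by
    rw [tendstoLocallyUniformlyOn_iff_forall_isCompact isOpen_ball]
    intro S hS hSc
    obtain ⟨R, hR, hR1⟩ : ∃ R < 1, S ⊆ closedBall 0 R := by
      rcases S.eq_empty_or_nonempty with rfl | hne
      · exact ⟨0, one_pos, empty_subset _⟩
      obtain ⟨z, hz, hmax⟩ := hSc.exists_isMaxOn hne continuous_norm.continuousOn
      exact ⟨‖z‖, by simpa using hS hz, fun w hw => by simpa using hmax hw⟩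
    refine UniformCauchySeqOn.tendstoUniformlyOn_of_tendsto ?_ fun z _ => hF z
    rw [Metric.uniformCauchySeqOn_iff]
    intro ε hε
    set K := ∑' n : ℕ, ((n : ℝ) + 1) * R ^ n
    obtain ⟨N, hN⟩ := Metric.cauchySeq_iff.1 hu (ε / (|K| + 1)) (by positivity)
    refine ⟨N, fun m hm n hn z hz => ?_⟩
    have h1 := hN m hm n hn
    rw [dist_eq_norm, lt_div_iff₀ (by positivity)] at h1
    rw [dist_eq_norm, ← hsub]
    refine lt_of_le_of_lt (norm_apply_le (u m - u n) hR (by simpa using hR1 hz)) ?_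
    refine lt_of_le_of_lt ?_ h1
    rw [mul_comm]
    gcongr
    linarith [le_abs_self K]
  have hFh : IsHolo F := by
    refine ⟨hloc.differentiableOn (Filter.Eventually.of_forall fun n => (u n).isHolo.1)
      isOpen_ball, fun z hz => ?_⟩
    refine tendsto_nhds_unique (hF z) ?_
    simp only [(u _).isHolo.2 z hz]
    exact tendsto_const_nhds
  have hdiff : ∀ ε > 0, ∃ N, ∀ n ≥ N, rho p 1 (F - u n) ≤ ENNReal.ofReal ε := by
    intro ε hε
    obtain ⟨N, hN⟩ := Metric.cauchySeq_iff.1 hu ε hε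
    refine ⟨N, fun n hn => rho_le_of_tendsto hp.out (h := fun m => (u m - u n : RM p 1))
      (fun m => (u m - u n : RM p 1).isHolo.measurable)
      (fun z => (hF z).sub_const (u n z)) ?_⟩
    filter_upwards [Filter.eventually_ge_atTop N] with m hm
    rw [← ofReal_norm_RM, ← dist_eq_norm]
    exact ENNReal.ofReal_le_ofReal (hN m hm n hn).le
  have hfin : rho p 1 F < ∞ := by
    obtain ⟨N, hN⟩ := hdiff 1 one_pos
    have h1 : F = (F - u N) + u N := by simp
    rw [h1]
    refine (rho_add_le hp.out le_rfl (hFh.measurable.sub (u N).isHolo.measurable)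
      (u N).isHolo.measurable).trans_lt (ENNReal.add_lt_top.2 ⟨?_, (u N).2.2⟩)
    exact (hN N le_rfl).trans_lt ENNReal.ofReal_lt_top
  refine ⟨RM.mk F hFh hfin, ?_⟩
  rw [Metric.tendsto_atTop]
  intro ε hε
  obtain ⟨N, hN⟩ := hdiff (ε / 2) (by positivity)
  refine ⟨N, fun n hn => ?_⟩
  rw [dist_comm, dist_eq_norm, norm_def]
  refine lt_of_le_of_lt (ENNReal.toReal_mono ENNReal.ofReal_ne_top (hN n hn)) ?_
  rw [ENNReal.toReal_ofReal (by positivity)]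
  linarith

end Complete

/-! ### The integration operator and its boundedness -/

section IntegrationOperator

/-- Hardy's inequality on one ray plus Minkowski. Boundedness of the operator uses `δ = 0`; the
compactness estimate needs the additive error `δ` as well. -/
theorem exists_radialMean_le {p : ℝ} (hp : 1 ≤ p) : ∃ H : ℝ≥0∞, H ≠ ∞ ∧
    ∀ {h f : ℂ → ℂ}, Measurable f → ∀ (K δ : ℝ≥0∞) (t : ℝ),
    (∀ r ∈ Ico (0 : ℝ) 1, ‖h (r * Complex.exp (t * Complex.I))‖ₑ ≤
      K * (∫⁻ s in Ioc 0 r, ‖f (s * Complex.exp (t * Complex.I))‖ₑ * ENNReal.ofReal (1 - s)⁻¹) + δ) →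
    radialMean p h t ≤ K * H * radialMean p f t + δ := by
  have hp0 : 0 < p := by linarith
  have hp1 : (0 : ℝ) ≤ 1 / p := by positivity
  obtain ⟨C, hC, hardy⟩ := hardy_inequality hp
  refine ⟨C ^ (1 / p), ENNReal.rpow_ne_top_of_nonneg hp1 hC, fun {h f} hf K δ t hb => ?_⟩
  set G : ℝ → ℝ≥0∞ := fun r =>
    ∫⁻ s in Ioc 0 r, ‖f (s * Complex.exp (t * Complex.I))‖ₑ * ENNReal.ofReal (1 - s)⁻¹ with hG
  have hGm : Measurable G := by
    refine Monotone.measurable fun a b hab => lintegral_mono_set (Ioc_subset_Ioc_right hab)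
  have h1 := ENNReal.lintegral_Lp_add_le (μ := volume.restrict (Ico (0 : ℝ) 1))
    (hGm.const_mul K).aemeasurable (measurable_const (a := δ)).aemeasurable hp
  have h2 : (∫⁻ _ in Ico (0 : ℝ) 1, δ ^ p) ^ (1 / p) = δ := by
    rw [setLIntegral_const, Real.volume_Ico, sub_zero, ENNReal.ofReal_one, mul_one,
      ← ENNReal.rpow_mul, mul_one_div_cancel hp0.ne', ENNReal.rpow_one]
  have h3 : (∫⁻ r in Ico (0 : ℝ) 1, (K * G r) ^ p) ^ (1 / p) ≤
      K * C ^ (1 / p) * radialMean p f t := by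
    simp_rw [ENNReal.mul_rpow_of_nonneg _ _ hp0.le]
    rw [lintegral_const_mul _ (hGm.pow_const p), ENNReal.mul_rpow_of_nonneg _ _ hp1,
      ← ENNReal.rpow_mul, mul_one_div_cancel hp0.ne', ENNReal.rpow_one, mul_assoc]
    gcongr
    rw [radialMean, ← ENNReal.mul_rpow_of_nonneg _ _ hp1]
    gcongr
    exact hardy _ (measurable_ray hf t).enorm
  calc radialMean p h t ≤ (∫⁻ r in Ico (0 : ℝ) 1, (K * G r + δ) ^ p) ^ (1 / p) := by
        unfold radialMean
        gcongr ?_ ^ (1 / p)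
        refine setLIntegral_mono' measurableSet_Ico fun r hr => ?_
        gcongr
        exact hb r hr
    _ ≤ _ := h1
    _ ≤ _ := by
        rw [h2]
        gcongr

theorem rho_le_of_radialMean_le {p : ℝ} {h f : ℂ → ℂ} (hf : Measurable f) {K δ : ℝ≥0∞}
    (H : ∀ t, radialMean p h t ≤ K * radialMean p f t + δ) : rho p 1 h ≤ K * rho p 1 f + δ := by
  rw [rho_one, rho_one]
  have hpi : ENNReal.ofReal (2 * Real.pi) ≠ 0 := by simp [Real.pi_pos]
  calc _ ≤ (ENNReal.ofReal (2 * Real.pi))⁻¹ *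
        ∫⁻ t in Ioc (0 : ℝ) (2 * Real.pi), (K * radialMean p f t + δ) := by
        gcongr with t
        exact H t
    _ = _ := by
        rw [lintegral_add_right _ measurable_const,
          lintegral_const_mul _ (measurable_radialMean hf p), setLIntegral_const, Real.volume_Ioc,
          sub_zero, mul_add, mul_left_comm, mul_left_comm _ δ,
          ENNReal.inv_mul_cancel hpi ENNReal.ofReal_ne_top, mul_one]

/-- The integration operator, with values extended by zero off the disc. -/
def integrationFun (g f : ℂ → ℂ) : ℂ → ℂ := (ball (0 : ℂ) 1).indicator (integrationOp g f)

variable {g f : ℂ → ℂ}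

theorem continuousOn_mul_deriv (hg : DifferentiableOn ℂ g (ball 0 1))
    (hf : DifferentiableOn ℂ f (ball 0 1)) : ContinuousOn (fun z => f z * deriv g z) (ball 0 1) :=
  hf.continuousOn.mul (hg.deriv isOpen_ball).continuousOn

theorem mem_ball_of_mem_uIcc {e : ℂ} {a b : ℝ} (ha : ‖(a * e : ℂ)‖ < 1) (hb : ‖(b * e : ℂ)‖ < 1) {s : ℝ}
    (hs : s ∈ uIcc a b) : (s * e : ℂ) ∈ ball (0 : ℂ) 1 := by
  have h1 : |s| ≤ max |a| |b| := by
    rcases le_total a b with h | h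
    · rw [uIcc_of_le h] at hs
      exact abs_le_max_abs_abs hs.1 hs.2
    · rw [uIcc_of_ge h] at hs
      rw [max_comm]
      exact abs_le_max_abs_abs hs.1 hs.2
  rw [mem_ball_zero_iff, norm_mul, Complex.norm_real, Real.norm_eq_abs]
  rw [norm_mul, Complex.norm_real, Real.norm_eq_abs] at ha hb
  rcases le_max_iff.1 h1 with h | h
  · exact lt_of_le_of_lt (by gcongr) ha
  · exact lt_of_le_of_lt (by gcongr) hb

theorem intervalIntegrable_ray (hg : DifferentiableOn ℂ g (ball 0 1))
    (hf : DifferentiableOn ℂ f (ball 0 1)) {e : ℂ} {a b : ℝ} (ha : ‖(a * e : ℂ)‖ < 1)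
    (hb : ‖(b * e : ℂ)‖ < 1) :
    IntervalIntegrable (fun s : ℝ => f (s * e) * deriv g (s * e) * e) volume a b := by
  refine ContinuousOn.intervalIntegrable ?_
  exact ((continuousOn_mul_deriv hg hf).comp (f := fun s : ℝ => (s * e : ℂ)) (by fun_prop)
    fun s hs => mem_ball_of_mem_uIcc ha hb hs).mul continuousOn_const

theorem integral_ray (hg : DifferentiableOn ℂ g (ball 0 1)) (hf : DifferentiableOn ℂ f (ball 0 1))
    {P : ℂ → ℂ} (hP : ∀ z ∈ ball (0 : ℂ) 1, HasDerivAt P (f z * deriv g z) z) {e : ℂ} {a b : ℝ}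
    (ha : ‖(a * e : ℂ)‖ < 1) (hb : ‖(b * e : ℂ)‖ < 1) :
    ∫ s in a..b, f (s * e) * deriv g (s * e) * e = P (b * e) - P (a * e) := by
  refine intervalIntegral.integral_eq_sub_of_hasDerivAt (f := fun s : ℝ => P (s * e))
    (fun s hs => ?_) (intervalIntegrable_ray hg hf ha hb)
  have h1 := hP _ (mem_ball_of_mem_uIcc ha hb hs)
  have h2 : HasDerivAt (fun w : ℂ => w * e) e (s : ℂ) := by
    simpa using (hasDerivAt_id (s : ℂ)).mul_const e
  exact (HasDerivAt.comp (s : ℂ) h1 h2).comp_ofReal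

/-- Identifying the ray integral with a primitive on the disc yields holomorphy and the derivative
without differentiating under the integral sign. -/
theorem exists_primitive (hg : DifferentiableOn ℂ g (ball 0 1))
    (hf : DifferentiableOn ℂ f (ball 0 1)) :
    ∃ P : ℂ → ℂ, (∀ z ∈ ball (0 : ℂ) 1, HasDerivAt P (f z * deriv g z) z) ∧
      ∀ z ∈ ball (0 : ℂ) 1, integrationFun g f z = P z := by
  obtain ⟨P, hP0, hP⟩ :=
    (DifferentiableOn.isExactOn_ball (hf.mul (hg.deriv isOpen_ball))).with_val_at 0 0
  refine ⟨P, hP, fun z hz => ?_⟩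
  rw [integrationFun, indicator_of_mem hz, integrationOp,
    integral_ray hg hf hP (by simp) (by simpa using hz)]
  simp [hP0]

theorem hasDerivAt_integrationFun (hg : DifferentiableOn ℂ g (ball 0 1))
    (hf : DifferentiableOn ℂ f (ball 0 1)) {z : ℂ} (hz : z ∈ ball (0 : ℂ) 1) :
    HasDerivAt (integrationFun g f) (f z * deriv g z) z := by
  obtain ⟨P, hP, hPe⟩ := exists_primitive hg hf
  refine (hP z hz).congr_of_eventuallyEq ?_
  filter_upwards [isOpen_ball.mem_nhds hz] with w hw using hPe w hw

theorem isHolo_integrationFun (hg : DifferentiableOn ℂ g (ball 0 1))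
    (hf : DifferentiableOn ℂ f (ball 0 1)) : IsHolo (integrationFun g f) :=
  ⟨fun _ hz => (hasDerivAt_integrationFun hg hf hz).differentiableAt.differentiableWithinAt,
    fun _ hz => indicator_of_notMem hz _⟩

theorem enorm_integrationFun_sub_le (hg : DifferentiableOn ℂ g (ball 0 1))
    (hf : DifferentiableOn ℂ f (ball 0 1)) (t : ℝ) {a b : ℝ} (ha : 0 ≤ a) (hab : a ≤ b)
    (hb : b < 1) :
    ‖integrationFun g f (b * Complex.exp (t * Complex.I)) -
        integrationFun g f (a * Complex.exp (t * Complex.I))‖ₑ ≤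
      ∫⁻ s in Ioc a b, ‖f (s * Complex.exp (t * Complex.I))‖ₑ *
        ‖deriv g (s * Complex.exp (t * Complex.I))‖ₑ := by
  obtain ⟨P, hP, hPe⟩ := exists_primitive hg hf
  have ha' := polar_mem_ball ⟨ha, hab.trans_lt hb⟩ t
  have hb' := polar_mem_ball ⟨ha.trans hab, hb⟩ t
  rw [hPe _ ha', hPe _ hb', ← integral_ray hg hf hP (mem_ball_zero_iff.1 ha')
    (mem_ball_zero_iff.1 hb'), intervalIntegral.integral_of_le hab]
  refine (enorm_integral_le_lintegral_enorm _).trans (lintegral_mono fun s => ?_)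
  have he : ‖Complex.exp (t * Complex.I)‖ₑ = 1 := by
    rw [← ofReal_norm, Complex.norm_exp_ofReal_mul_I, ENNReal.ofReal_one]
  rw [enorm_mul, enorm_mul, he, mul_one]

theorem integrationFun_zero : integrationFun g f 0 = 0 := by
  simp [integrationFun, integrationOp]

theorem integrationFun_add {f' : ℂ → ℂ} (hg : DifferentiableOn ℂ g (ball 0 1))
    (hf : DifferentiableOn ℂ f (ball 0 1)) (hf' : DifferentiableOn ℂ f' (ball 0 1)) :
    integrationFun g (f + f') = integrationFun g f + integrationFun g f' := by
  ext z
  by_cases hz : z ∈ ball (0 : ℂ) 1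
  · have h1 : ‖((0 : ℝ) * z : ℂ)‖ < 1 := by simp
    have h2 : ‖((1 : ℝ) * z : ℂ)‖ < 1 := by simpa using hz
    simp only [integrationFun, Pi.add_apply, indicator_of_mem hz, integrationOp, add_mul]
    exact intervalIntegral.integral_add (intervalIntegrable_ray hg hf h1 h2)
      (intervalIntegrable_ray hg hf' h1 h2)
  · simp only [integrationFun, Pi.add_apply, indicator_of_notMem hz, add_zero]

theorem integrationFun_smul (c : ℂ) : integrationFun g (c • f) = c • integrationFun g f := by
  ext z
  by_cases hz : z ∈ ball (0 : ℂ) 1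
  · simp only [integrationFun, Pi.smul_apply, indicator_of_mem hz, integrationOp, smul_eq_mul,
      mul_assoc]
    exact intervalIntegral.integral_const_mul _ _
  · simp only [integrationFun, Pi.smul_apply, indicator_of_notMem hz, smul_zero]

theorem IsBloch.exists_bound (hg : IsBloch g) :
    ∃ C : ℝ, 0 ≤ C ∧ ∀ z ∈ ball (0 : ℂ) 1, ‖deriv g z‖ ≤ C * (1 - ‖z‖)⁻¹ := by
  obtain ⟨-, C, hC⟩ := hg
  refine ⟨|C|, abs_nonneg C, fun z hz => ?_⟩
  have hz1 : ‖z‖ < 1 := by simpa using hz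
  have hz0 := norm_nonneg z
  rw [← div_eq_mul_inv, le_div_iff₀ (by linarith)]
  refine le_trans ?_ ((hC z hz).trans (le_abs_self C))
  rw [mul_comm]
  gcongr
  nlinarith

variable {p : ℝ} [hp : Fact (1 ≤ p)]

/-- The bound holds angle by angle, which is more than boundedness of the operator: decay of the
radial means of `f` at a given angle passes to its image. -/
theorem exists_radialMean_integrationFun_le (p : ℝ) [hp : Fact (1 ≤ p)] (hg : IsBloch g) :
    ∃ K : ℝ≥0∞, K ≠ ∞ ∧ ∀ f, IsHolo f → ∀ t,
      radialMean p (integrationFun g f) t ≤ K * radialMean p f t := by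
  obtain ⟨C, hC0, hC⟩ := hg.exists_bound
  obtain ⟨H, hH, hle⟩ := exists_radialMean_le hp.out
  refine ⟨ENNReal.ofReal C * H, ENNReal.mul_ne_top ENNReal.ofReal_ne_top hH, fun f hf t => ?_⟩
  have := hle (h := integrationFun g f) hf.measurable (ENNReal.ofReal C) 0 t fun r hr => ?_
  · simpa using this
  have h1 := enorm_integrationFun_sub_le hg.1 hf.1 t le_rfl hr.1 hr.2
  rw [Complex.ofReal_zero, zero_mul, integrationFun_zero, sub_zero] at h1
  rw [add_zero, ← lintegral_const_mul' _ _ ENNReal.ofReal_ne_top]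
  refine h1.trans (setLIntegral_mono' measurableSet_Ioc fun s hs => ?_)
  have hs' : s ∈ Ico (0 : ℝ) 1 := ⟨hs.1.le, hs.2.trans_lt hr.2⟩
  have h2 := hC _ (polar_mem_ball hs' t)
  rw [norm_polar hs'.1] at h2
  rw [mul_left_comm]
  gcongr
  rw [← ofReal_norm, ← ENNReal.ofReal_mul hC0]
  exact ENNReal.ofReal_le_ofReal h2

theorem exists_integrationCLM (p : ℝ) [hp : Fact (1 ≤ p)] (hg : IsBloch g) :
    ∃ T : RM p 1 →L[ℂ] RM p 1, ∀ f : RM p 1, (T f : ℂ → ℂ) = integrationFun g f := by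
  obtain ⟨K, hK, hle⟩ := exists_radialMean_integrationFun_le p hg
  have hrho : ∀ f : RM p 1, rho p 1 (integrationFun g f) ≤ K * rho p 1 f := fun f => by
    have := rho_le_of_radialMean_le (p := p) (K := K) (δ := 0) f.isHolo.measurable fun t => by
      simpa using hle f f.isHolo t
    simpa using this
  refine ⟨LinearMap.mkContinuous
    { toFun := fun f => RM.mk (integrationFun g f) (isHolo_integrationFun hg.1 f.isHolo.1)
        ((hrho f).trans_lt (ENNReal.mul_lt_top hK.lt_top f.2.2))
      map_add' := fun f f' => RM.ext (integrationFun_add hg.1 f.isHolo.1 f'.isHolo.1)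
      map_smul' := fun c f => RM.ext (integrationFun_smul c) } K.toReal fun f => ?_, fun f => rfl⟩
  rw [norm_def, norm_def, ← ENNReal.toReal_mul]
  exact ENNReal.toReal_mono (ENNReal.mul_ne_top hK f.2.2.ne) (hrho f)

end IntegrationOperator

/-! ### Compactness under the little Bloch condition -/

section Compact

variable {p : ℝ} [hp : Fact (1 ≤ p)]

theorem coeff_add {f f' : ℂ → ℂ} (hf : IsHolo f) (hf' : IsHolo f') (n : ℕ) :
    coeff n (f + f') = coeff n f + coeff n f' := by
  have h0 : (0 : ℂ) ∈ ball (0 : ℂ) 1 := mem_ball_self one_pos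
  have hc : ∀ {h : ℂ → ℂ}, IsHolo h → ContDiffAt ℂ n h 0 := fun hh =>
    (hh.1.analyticOnNhd isOpen_ball 0 h0).contDiffAt
  rw [coeff, iteratedDeriv_add (hc hf) (hc hf'), mul_add]
  rfl

theorem coeff_smul {f : ℂ → ℂ} (hf : IsHolo f) (c : ℂ) (n : ℕ) :
    coeff n (c • f) = c * coeff n f := by
  have h0 : (0 : ℂ) ∈ ball (0 : ℂ) 1 := mem_ball_self one_pos
  have hc : ContDiffAt ℂ n f 0 := (hf.1.analyticOnNhd isOpen_ball 0 h0).contDiffAt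
  rw [coeff, coeff, iteratedDeriv_const_smul hc c, smul_eq_mul, mul_left_comm]

/-- The Taylor coefficient functional on `RM(p,1)`. -/
def coeffCLM (p : ℝ) [hp : Fact (1 ≤ p)] (n : ℕ) : StrongDual ℂ (RM p 1) :=
  LinearMap.mkContinuous
    { toFun := fun f => coeff n f
      map_add' := fun f f' => coeff_add f.isHolo f'.isHolo n
      map_smul' := fun c f => coeff_smul f.isHolo c n } (n + 1) fun f => norm_coeff_le f n

theorem rho_le_of_norm_le {p : ℝ} (hp : 1 ≤ p) {h : ℂ → ℂ} {M : ℝ}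
    (hM : ∀ z ∈ ball (0 : ℂ) 1, ‖h z‖ ≤ M) : rho p 1 h ≤ ENNReal.ofReal M := by
  obtain ⟨H, hH, hle⟩ := exists_radialMean_le hp
  -- The ray estimate with `f = 0` and multiplier `0` leaves only the additive term.
  have := rho_le_of_radialMean_le (p := p) (h := h) (f := 0) measurable_zero (K := 0 * H)
    (δ := ENNReal.ofReal M) fun t => hle measurable_zero 0 _ t fun r hr => by
      rw [zero_mul, zero_add, ← ofReal_norm]
      exact ENNReal.ofReal_le_ofReal (hM _ (polar_mem_ball hr t))
  simpa using this

theorem isHolo_indicator {h : ℂ → ℂ} (hh : DifferentiableOn ℂ h (ball 0 1)) :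
    IsHolo ((ball (0 : ℂ) 1).indicator h) :=
  ⟨hh.congr fun _ hz => indicator_of_mem hz _, fun _ hz => indicator_of_notMem hz _⟩

/-- The monomial `z ^ n` as an element of `RM(p,1)`. -/
def monomial (p : ℝ) [hp : Fact (1 ≤ p)] (n : ℕ) : RM p 1 :=
  RM.mk ((ball (0 : ℂ) 1).indicator fun z => z ^ n)
    (isHolo_indicator (differentiable_id.pow n).differentiableOn)
    ((rho_le_of_norm_le hp.out (M := 1) fun z hz => by
      rw [indicator_of_mem hz, norm_pow]
      exact pow_le_one₀ (norm_nonneg z) (by simpa using (mem_ball_zero_iff.1 hz).le)).trans_lt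
      ENNReal.ofReal_lt_top)

theorem monomial_apply (n : ℕ) {z : ℂ} (hz : z ∈ ball (0 : ℂ) 1) : monomial p n z = z ^ n :=
  indicator_of_mem hz _

/-- The Taylor polynomial of the dilation `z ↦ f (s z)`, as an operator of finite rank. -/
def taylorDilation (p : ℝ) [hp : Fact (1 ≤ p)] (s : ℝ) (N : ℕ) : RM p 1 →L[ℂ] RM p 1 :=
  ∑ n ∈ Finset.range N, ((s : ℂ) ^ n • coeffCLM p n).smulRight (monomial p n)

/-- Evaluation at a point as a linear map. -/
def evalLM (p : ℝ) [hp : Fact (1 ≤ p)] (z : ℂ) : RM p 1 →ₗ[ℂ] ℂ where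
  toFun f := f z
  map_add' _ _ := rfl
  map_smul' _ _ := rfl

theorem taylorDilation_apply (s : ℝ) (N : ℕ) (f : RM p 1) {z : ℂ} (hz : z ∈ ball (0 : ℂ) 1) :
    taylorDilation p s N f z = ∑ n ∈ Finset.range N, coeff n f * (s * z) ^ n := by
  change evalLM p z (taylorDilation p s N f) = _
  simp only [taylorDilation, sum_apply, map_sum]
  refine Finset.sum_congr rfl fun n _ => ?_
  rw [ContinuousLinearMap.smulRight_apply, map_smul]
  change ((s : ℂ) ^ n * coeff n f) * (monomial p n z) = _
  rw [monomial_apply n hz, mul_pow]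
  ring

theorem isCompactOperator_taylorDilation (s : ℝ) (N : ℕ) :
    IsCompactOperator (taylorDilation p s N) := by
  unfold taylorDilation
  induction N with
  | zero => simpa using isCompactOperator_zero
  | succ N ih =>
    rw [Finset.sum_range_succ]
    refine IsCompactOperator.add ih ?_
    have h1 : IsCompactOperator ((s : ℂ) ^ N • coeffCLM p N) :=
      isCompactOperator_of_locallyCompactSpace_dom _
    exact h1.clm_comp (ContinuousLinearMap.toSpanSingleton ℂ (monomial p N))

/-- For `z` of modulus `r`, `T f (z) - T f (s z)` is an integral over `[s r, r]`. Beyond radius `R`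
the smallness of `g'` and Hardy's inequality apply; inside it the integrand is at most `M ‖f‖` and
the interval has length at most `1 - s`. The Taylor tail of the dilated function is uniformly small.
Each of the three errors is at most `ε / 4 * ‖f‖`. -/
theorem isCompactOperator_of_little_bloch {g : ℂ → ℂ} (hg : IsBloch g)
    (hlittle : ∀ ε > 0, ∃ R < 1, ∀ z ∈ ball (0 : ℂ) 1, R ≤ ‖z‖ → (1 - ‖z‖) * ‖deriv g z‖ ≤ ε)
    (T : RM p 1 →L[ℂ] RM p 1) (hT : ∀ f : RM p 1, (T f : ℂ → ℂ) = integrationFun g f) :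
    IsCompactOperator T := by
  obtain ⟨C, hC0, hC⟩ := hg.exists_bound
  obtain ⟨H, hH, hle⟩ := exists_radialMean_le hp.out
  have hclosed : IsClosed {S : RM p 1 →L[ℂ] RM p 1 | IsCompactOperator S} :=
    isClosed_setOfPred_isCompactOperator
  -- The parameters are chosen in the order `R`, `s`, `N`, each depending on the preceding ones.
  refine hclosed.closure_subset (Metric.mem_closure_iff.2 fun ε hε => ?_)
  set ε₁ := ε / (4 * (H.toReal + 1)) with hε₁
  have hH0 : 0 ≤ H.toReal := ENNReal.toReal_nonneg
  have hε₁0 : 0 < ε₁ := by positivity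
  obtain ⟨R', hR', hlit⟩ := hlittle ε₁ hε₁0
  obtain ⟨R, hR0, hR1, hRR⟩ : ∃ R : ℝ, 0 ≤ R ∧ R < 1 ∧ R' ≤ R :=
    ⟨max R' 0, le_max_right _ _, max_lt hR' one_pos, le_max_left _ _⟩
  set K := ∑' n : ℕ, ((n : ℝ) + 1) * R ^ n
  have hK0 : 0 ≤ K := tsum_nonneg fun n => by positivity
  set M := K * (C * (1 - R)⁻¹) with hM
  have h1R : 0 < 1 - R := by linarith
  have hM0 : 0 ≤ M := by positivity
  obtain ⟨s, hs0, hs1, hs⟩ : ∃ s : ℝ, 0 ≤ s ∧ s < 1 ∧ M * (1 - s) ≤ ε / 4 := by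
    have hq : 0 < ε / (4 * (M + 1)) := by positivity
    refine ⟨max 0 (1 - ε / (4 * (M + 1))), le_max_left _ _, max_lt one_pos (by linarith), ?_⟩
    calc M * (1 - max 0 (1 - ε / (4 * (M + 1)))) ≤ M * (ε / (4 * (M + 1))) := by
          gcongr
          linarith [le_max_right 0 (1 - ε / (4 * (M + 1)))]
      _ ≤ (M + 1) * (ε / (4 * (M + 1))) := by gcongr; linarith
      _ = ε / 4 := by field_simp
  have hsum := summable_succ_mul_pow hs0 hs1
  obtain ⟨N, hN⟩ : ∃ N : ℕ, (∑' n : ℕ, (((n + N : ℕ) : ℝ) + 1) * s ^ (n + N)) * ‖T‖ ≤ ε / 4 := by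
    have h1 := (tendsto_sum_nat_add fun n : ℕ => ((n : ℝ) + 1) * s ^ n).mul_const ‖T‖
    rw [zero_mul] at h1
    exact (h1.eventually_le_const (by positivity : 0 < ε / 4)).exists
  set τ := ∑' n : ℕ, (((n + N : ℕ) : ℝ) + 1) * s ^ (n + N) with hτ
  have hτs : Summable fun n : ℕ => (((n + N : ℕ) : ℝ) + 1) * s ^ (n + N) :=
    (summable_nat_add_iff N).2 hsum
  have hτ0 : 0 ≤ τ := tsum_nonneg fun n => by positivity
  refine ⟨(taylorDilation p s N).comp T, (isCompactOperator_taylorDilation s N).comp_clm T, ?_⟩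
  rw [dist_eq_norm]
  refine lt_of_le_of_lt (ContinuousLinearMap.opNorm_le_bound _ (M := 3 * ε / 4) (by positivity)
    fun f => ?_) (by linarith)
  set F := T f with hF
  have hnf := norm_nonneg f
  have hfh := f.isHolo
  have htail : ∀ z ∈ ball (0 : ℂ) 1,
      ‖F (s * z) - taylorDilation p s N F z‖ ≤ τ * (‖T‖ * ‖f‖) := by
    intro z hz
    have hz1 : ‖z‖ < 1 := by simpa using hz
    have hsz : (s * z : ℂ) ∈ ball (0 : ℂ) 1 := by
      rw [mem_ball_zero_iff, norm_mul, Complex.norm_real, Real.norm_of_nonneg hs0]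
      exact mul_lt_one_of_nonneg_of_lt_one_left hs0 hs1 hz1.le
    have h1 := hasSum_coeff F.isHolo hsz
    have h2 := (hasSum_nat_add_iff' N).2 h1
    rw [taylorDilation_apply s N F hz, ← h2.tsum_eq]
    refine tsum_of_norm_bounded (hτs.hasSum.mul_right (‖T‖ * ‖f‖)) fun n => ?_
    rw [norm_mul, norm_pow, norm_mul, Complex.norm_real, Real.norm_of_nonneg hs0]
    calc ‖coeff (n + N) F‖ * (s * ‖z‖) ^ (n + N)
        ≤ ((((n + N : ℕ) : ℝ) + 1) * (‖T‖ * ‖f‖)) * (s * 1) ^ (n + N) := by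
          gcongr
          exact (norm_coeff_le F (n + N)).trans (by gcongr; exact T.le_opNorm f)
      _ = _ := by rw [mul_one]; ring
  have hrad : ∀ t, radialMean p (F - taylorDilation p s N F : RM p 1) t ≤
      ENNReal.ofReal ε₁ * H * radialMean p f t + ENNReal.ofReal (ε / 2 * ‖f‖) := by
    intro t
    refine hle hfh.measurable _ _ t fun r hr => ?_
    have hz := polar_mem_ball hr t
    set e := Complex.exp (t * Complex.I) with he
    have hsr : s * r ≤ r := mul_le_of_le_one_left hr.1 hs1.le
    have hinc := enorm_integrationFun_sub_le hg.1 hfh.1 t (mul_nonneg hs0 hr.1) hsr hr.2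
    rw [← hT, ← hF, ← he] at hinc
    have hpt : ∀ x ∈ Ioc (s * r) r, ‖f (x * e)‖ₑ * ‖deriv g (x * e)‖ₑ ≤
        ENNReal.ofReal ε₁ * (‖f (x * e)‖ₑ * ENNReal.ofReal (1 - x)⁻¹) +
          ENNReal.ofReal (M * ‖f‖) := by
      intro x hx
      have hx0 : 0 ≤ x := (mul_nonneg hs0 hr.1).trans hx.1.le
      have hx1 : x < 1 := hx.2.trans_lt hr.2
      have hxb := polar_mem_ball ⟨hx0, hx1⟩ t
      have hxn := norm_polar hx0 t
      rw [← he] at hxb hxn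
      have h1x : 0 < 1 - x := by linarith
      rcases le_total R x with hRx | hRx
      · refine le_trans ?_ le_self_add
        rw [mul_left_comm]
        gcongr
        rw [← ofReal_norm, ← ENNReal.ofReal_mul hε₁0.le]
        apply ENNReal.ofReal_le_ofReal
        have := hlit _ hxb (by rw [hxn]; exact hRR.trans hRx)
        rw [hxn] at this
        rw [← div_eq_mul_inv, le_div_iff₀ h1x]
        linarith
      · refine le_trans ?_ le_add_self
        rw [← ofReal_norm, ← ofReal_norm, ← ENNReal.ofReal_mul (norm_nonneg _)]
        apply ENNReal.ofReal_le_ofReal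
        have h1 : ‖f (x * e)‖ ≤ K * ‖f‖ := norm_apply_le f hR1 (by rw [hxn]; exact hRx)
        have h2 : ‖deriv g (x * e)‖ ≤ C * (1 - R)⁻¹ := by
          refine (hC _ hxb).trans ?_
          rw [hxn]
          gcongr
        calc _ ≤ (K * ‖f‖) * (C * (1 - R)⁻¹) := by gcongr
          _ = _ := by rw [hM]; ring
    have hinc2 : ‖F (r * e) - F (s * (r * e))‖ₑ ≤
        ENNReal.ofReal ε₁ * (∫⁻ x in Ioc 0 r, ‖f (x * e)‖ₑ * ENNReal.ofReal (1 - x)⁻¹) +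
          ENNReal.ofReal (ε / 4 * ‖f‖) := by
      have e1 : (s * (r * e) : ℂ) = ((s * r : ℝ) : ℂ) * e := by push_cast; ring
      rw [e1]
      refine (hinc.trans (setLIntegral_mono' measurableSet_Ioc hpt)).trans ?_
      rw [lintegral_add_right _ measurable_const, setLIntegral_const, Real.volume_Ioc,
        lintegral_const_mul' _ _ ENNReal.ofReal_ne_top, ← ENNReal.ofReal_mul (by positivity)]
      refine add_le_add ?_ (ENNReal.ofReal_le_ofReal ?_)
      · gcongr
        exact mul_nonneg hs0 hr.1
      · calc M * ‖f‖ * (r - s * r) = M * (1 - s) * r * ‖f‖ := by ring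
          _ ≤ M * (1 - s) * 1 * ‖f‖ := by
              have : 0 ≤ M * (1 - s) := mul_nonneg hM0 (by linarith)
              gcongr
              exact hr.2.le
          _ ≤ ε / 4 * ‖f‖ := by rw [mul_one]; gcongr
    have htail2 : ‖F (s * (r * e)) - taylorDilation p s N F (r * e)‖ₑ ≤
        ENNReal.ofReal (ε / 4 * ‖f‖) := by
      rw [← ofReal_norm]
      apply ENNReal.ofReal_le_ofReal
      refine (htail _ hz).trans ?_
      rw [← mul_assoc]
      gcongr
    have e2 : (F - taylorDilation p s N F : RM p 1) (r * e) =
        (F (r * e) - F (s * (r * e))) + (F (s * (r * e)) - taylorDilation p s N F (r * e)) := by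
      rw [RM.coe_sub, Pi.sub_apply]
      ring
    rw [e2]
    refine (enorm_add_le _ _).trans ((add_le_add hinc2 htail2).trans (le_of_eq ?_))
    rw [add_assoc, ← ENNReal.ofReal_add (by positivity) (by positivity)]
    congr 2
    ring
  have hfin := rho_le_of_radialMean_le hfh.measurable hrad
  change ‖F - taylorDilation p s N F‖ ≤ _
  rw [← ofReal_norm_RM, ← ofReal_norm_RM f, ← ENNReal.ofReal_toReal hH,
    ← ENNReal.ofReal_mul hε₁0.le, ← ENNReal.ofReal_mul (by positivity),
    ← ENNReal.ofReal_add (by positivity) (by positivity),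
    ENNReal.ofReal_le_ofReal_iff (by positivity)] at hfin
  refine hfin.trans ?_
  have h9 : ε₁ * H.toReal ≤ ε / 4 := by
    calc ε₁ * H.toReal ≤ ε₁ * (H.toReal + 1) := by gcongr; linarith
      _ = ε / 4 := by rw [hε₁]; field_simp
  calc _ ≤ ε / 4 * ‖f‖ + ε / 2 * ‖f‖ := by gcongr
    _ = _ := by ring

end Compact

/-! ### Peaking kernels -/

section TestFunctions

theorem norm_one_sub_conj_mul {w e : ℂ} (he : ‖e‖ = 1) :
    ‖1 - starRingEnd ℂ w * e‖ = ‖e - w‖ := by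
  have h1 : (starRingEnd ℂ e) * e = 1 := by
    rw [mul_comm, Complex.mul_conj, Complex.normSq_eq_norm_sq, he]
    norm_num
  calc ‖1 - starRingEnd ℂ w * e‖ = ‖starRingEnd ℂ (e - w) * e‖ := by
        rw [map_sub, sub_mul, h1]
    _ = ‖e - w‖ := by rw [norm_mul, he, mul_one, RCLike.norm_conj]

theorem lintegral_poisson {w : ℂ} (hw : ‖w‖ < 1) :
    ∫⁻ t in Ioc (0 : ℝ) (2 * Real.pi),
      ENNReal.ofReal ((1 - ‖w‖ ^ 2) / ‖Complex.exp (t * Complex.I) - w‖ ^ 2) =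
      ENNReal.ofReal (2 * Real.pi) := by
  have hpi : (0 : ℝ) ≤ 2 * Real.pi := by positivity
  have hne : ∀ t : ℝ, ‖Complex.exp (t * Complex.I) - w‖ ≠ 0 := fun t h => by
    rw [norm_eq_zero, sub_eq_zero] at h
    rw [← h, Complex.norm_exp_ofReal_mul_I] at hw
    exact lt_irrefl _ hw
  have hcont : Continuous fun t : ℝ => (1 - ‖w‖ ^ 2) / ‖Complex.exp (t * Complex.I) - w‖ ^ 2 :=
    Continuous.div (by fun_prop) (by fun_prop) fun t => pow_ne_zero 2 (hne t)
  have h := (diffContOnCl_const (c := (1 : ℂ)) (𝕜 := ℂ) (s := ball (0 : ℂ) 1)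
    ).circleAverage_poissonKernel_smul' (w := w) (by simpa using hw)
  simp only [Real.circleAverage, sub_zero, circleMap, zero_add, Complex.ofReal_one, one_mul,
    Complex.norm_exp_ofReal_mul_I, one_pow] at h
  have h2 : ∫ t in (0 : ℝ)..2 * Real.pi, (1 - ‖w‖ ^ 2) / ‖Complex.exp (t * Complex.I) - w‖ ^ 2 =
      2 * Real.pi := by
    have h3 := congrArg Complex.re h
    simp only [Complex.real_smul, mul_one, intervalIntegral.integral_ofReal] at h3
    rw [← Complex.ofReal_mul, Complex.ofReal_re, Complex.one_re] at h3
    field_simp at h3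
    linarith
  have h4 := ofReal_integral_eq_lintegral_ofReal (μ := volume.restrict (Ioc 0 (2 * Real.pi)))
    (hcont.integrableOn_Icc.mono_set (Ioc_subset_Icc_self (a := 0) (b := 2 * Real.pi)))
    (Filter.Eventually.of_forall fun t => div_nonneg (by nlinarith [norm_nonneg w]) (by positivity))
  rw [← intervalIntegral.integral_of_le hpi, h2] at h4
  exact h4.symm

theorem lintegral_one_sub_mul_inv_sq {a : ℝ} (ha : 0 ≤ a) (ha1 : a < 1) :
    ∫⁻ r in Ico (0 : ℝ) 1, ENNReal.ofReal (((1 - a * r) ^ 2)⁻¹) = ENNReal.ofReal (1 - a)⁻¹ := by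
  have hpos : ∀ r ∈ uIcc (0 : ℝ) 1, 0 < 1 - a * r := fun r hr => by
    rw [uIcc_of_le zero_le_one] at hr
    nlinarith [hr.1, hr.2]
  have hcont : ContinuousOn (fun r : ℝ => ((1 - a * r) ^ 2)⁻¹) (uIcc 0 1) :=
    ContinuousOn.inv₀ (by fun_prop) fun r hr => (pow_pos (hpos r hr) 2).ne'
  have hint := intervalIntegral.integral_eq_sub_of_hasDerivAt (f := fun r : ℝ => r / (1 - a * r))
    (f' := fun r => ((1 - a * r) ^ 2)⁻¹) (a := 0) (b := 1) (fun r hr => by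
      have h0 := (hpos r hr).ne'
      have h1 : HasDerivAt (fun r : ℝ => 1 - a * r) (-a) r := by
        simpa using ((hasDerivAt_id r).const_mul a).const_sub 1
      refine ((hasDerivAt_id' r).fun_div h1 h0).congr_deriv ?_
      rw [← one_div]
      congr 1
      ring) hcont.intervalIntegrable
  have hi := hcont.intervalIntegrable (μ := volume)
  rw [intervalIntegrable_iff_integrableOn_Ioc_of_le zero_le_one] at hi
  rw [setLIntegral_congr Ico_ae_eq_Ioc, ← ofReal_integral_eq_lintegral_ofReal hi,
    ← intervalIntegral.integral_of_le zero_le_one, hint]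
  · simp
  · exact Filter.Eventually.of_forall fun r => by positivity

/-- The normalised kernel `(1 - |w|)^{3 - 1/p} / (1 - w̄ z)^4`, extended by zero off the disc. -/
def peak (p : ℝ) (w : ℂ) : ℂ → ℂ := (ball (0 : ℂ) 1).indicator fun z =>
  ((1 - ‖w‖) ^ (3 - 1 / p) : ℝ) / (1 - starRingEnd ℂ w * z) ^ 4

variable {w : ℂ}

theorem one_sub_le_norm_one_sub_conj_mul (w z : ℂ) :
    1 - ‖w‖ * ‖z‖ ≤ ‖1 - starRingEnd ℂ w * z‖ := by
  have := norm_sub_norm_le 1 (starRingEnd ℂ w * z)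
  rwa [norm_one, norm_mul, RCLike.norm_conj] at this

theorem isHolo_peak (p : ℝ) (hw : ‖w‖ < 1) : IsHolo (peak p w) := by
  refine isHolo_indicator (DifferentiableOn.div (by fun_prop) (by fun_prop) fun z hz => ?_)
  have hz1 : ‖z‖ < 1 := by simpa using hz
  have h1 := one_sub_le_norm_one_sub_conj_mul w z
  have h2 : ‖w‖ * ‖z‖ < 1 := mul_lt_one_of_nonneg_of_lt_one_left (norm_nonneg w) hw hz1.le
  refine pow_ne_zero 4 (norm_pos_iff.1 (by linarith))

/-- The fourth power of `|1 - w̄ z|` is split evenly: two factors are at least `|e^{it} - w| / 2`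
and give a Poisson-type decay in the angle, two are at least `1 - |w| r` and are integrated in the
radius. -/
theorem norm_peak_le (p : ℝ) (hw : ‖w‖ < 1) {r : ℝ} (hr : r ∈ Ico (0 : ℝ) 1) (t : ℝ) :
    ‖peak p w (r * Complex.exp (t * Complex.I))‖ ≤ (1 - ‖w‖) ^ (3 - 1 / p) *
      (4 / ‖Complex.exp (t * Complex.I) - w‖ ^ 2) * ((1 - ‖w‖ * r) ^ 2)⁻¹ := by
  set e := Complex.exp (t * Complex.I)
  have he : ‖e‖ = 1 := Complex.norm_exp_ofReal_mul_I t
  have hd : 0 < 1 - ‖w‖ := by linarith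
  have hw0 := norm_nonneg w
  set X := ‖1 - starRingEnd ℂ w * (r * e)‖ with hX
  have h1 : 1 - ‖w‖ * r ≤ X := by
    have := one_sub_le_norm_one_sub_conj_mul w (r * e)
    rwa [norm_polar hr.1] at this
  have h0 : 0 < 1 - ‖w‖ * r := by nlinarith [hr.1, hr.2]
  have hA0 : 0 < ‖e - w‖ := by
    have := norm_sub_norm_le e w
    rw [he] at this
    linarith
  have h2 : ‖e - w‖ ≤ 2 * X := by
    rw [← norm_one_sub_conj_mul he]
    have h3 : 1 - starRingEnd ℂ w * e =
        (1 - starRingEnd ℂ w * (r * e)) - starRingEnd ℂ w * e * ((1 - r : ℝ) : ℂ) := by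
      push_cast
      ring
    rw [h3]
    refine (norm_sub_le _ _).trans ?_
    have hr2 : 0 ≤ 1 - r := by linarith [hr.2]
    rw [norm_mul, norm_mul, RCLike.norm_conj, he, Complex.norm_real, Real.norm_of_nonneg hr2]
    nlinarith
  have hX0 : 0 < X := h0.trans_le h1
  rw [peak, indicator_of_mem (polar_mem_ball hr t), norm_div, norm_pow, Complex.norm_real,
    Real.norm_of_nonneg (by positivity), ← hX]
  calc (1 - ‖w‖) ^ (3 - 1 / p) / X ^ 4
      = (1 - ‖w‖) ^ (3 - 1 / p) * (4 / (2 * X) ^ 2) * (X ^ 2)⁻¹ := by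
        field_simp
        ring
    _ ≤ _ := by gcongr

theorem radialMean_peak_le {p : ℝ} (hp : 1 ≤ p) (hw : ‖w‖ < 1) (t : ℝ) :
    radialMean p (peak p w) t ≤
      ENNReal.ofReal (4 * (1 - ‖w‖) / ‖Complex.exp (t * Complex.I) - w‖ ^ 2) := by
  have hp0 : 0 < p := by linarith
  have hp1 : (0 : ℝ) ≤ 1 / p := by positivity
  set d := 1 - ‖w‖ with hd
  have hd0 : 0 < d := by linarith
  set Q := d ^ (3 - 1 / p) * (4 / ‖Complex.exp (t * Complex.I) - w‖ ^ 2) with hQ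
  have hQ0 : 0 ≤ Q := by positivity
  have h1 : ∀ r ∈ Ico (0 : ℝ) 1, ‖peak p w (r * Complex.exp (t * Complex.I))‖ₑ ^ p ≤
      ENNReal.ofReal (Q ^ p * (d ^ (2 - 2 * p))) * ENNReal.ofReal (((1 - ‖w‖ * r) ^ 2)⁻¹) := by
    intro r hr
    have hx : d ≤ 1 - ‖w‖ * r := by nlinarith [hr.1, hr.2, norm_nonneg w]
    set x := 1 - ‖w‖ * r with hx'
    have hx0 : 0 < x := hd0.trans_le hx
    rw [← ENNReal.ofReal_mul (by positivity), ← ofReal_norm,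
      ENNReal.ofReal_rpow_of_nonneg (norm_nonneg _) hp0.le]
    apply ENNReal.ofReal_le_ofReal
    have e1 : ((x ^ 2)⁻¹) ^ p = x ^ (2 - 2 * p) * (x ^ 2)⁻¹ := by
      have : (x ^ 2)⁻¹ = x ^ (-2 : ℝ) := by
        rw [Real.rpow_neg hx0.le]
        norm_cast
      rw [this, ← Real.rpow_mul hx0.le, ← Real.rpow_add hx0]
      ring_nf
    calc _ ≤ (Q * (x ^ 2)⁻¹) ^ p := by
          gcongr
          exact norm_peak_le p hw hr t
      _ = Q ^ p * (x ^ (2 - 2 * p) * (x ^ 2)⁻¹) := by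
          rw [Real.mul_rpow hQ0 (by positivity), e1]
      -- As `p ≥ 1` and `x ≥ d`, all but the power `x^(-2)` is absorbed into `d`; the remaining
      -- integral is exactly `1 / d`.
      _ ≤ Q ^ p * (d ^ (2 - 2 * p) * (x ^ 2)⁻¹) := by
          gcongr ?_ * (?_ * _)
          exact Real.rpow_le_rpow_of_nonpos hd0 hx (by linarith)
      _ = _ := by ring
  calc radialMean p (peak p w) t
      ≤ (ENNReal.ofReal (Q ^ p * d ^ (2 - 2 * p)) * ENNReal.ofReal d⁻¹) ^ (1 / p) := by
        unfold radialMean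
        gcongr
        rw [hd, ← lintegral_one_sub_mul_inv_sq (norm_nonneg w) hw,
          ← lintegral_const_mul' _ _ ENNReal.ofReal_ne_top]
        exact setLIntegral_mono' measurableSet_Ico h1
    _ = ENNReal.ofReal (4 * d / ‖Complex.exp (t * Complex.I) - w‖ ^ 2) := by
        rw [← ENNReal.ofReal_mul (by positivity),
          ENNReal.ofReal_rpow_of_nonneg (by positivity) hp1]
        congr 1
        have e2 : Q ^ p * d ^ (2 - 2 * p) * d⁻¹ = Q ^ p * d ^ (1 - 2 * p) := by
          rw [mul_assoc, ← Real.rpow_neg_one d, ← Real.rpow_add hd0]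
          ring_nf
        rw [e2, Real.mul_rpow (by positivity) (by positivity), ← Real.rpow_mul hQ0,
          mul_one_div_cancel hp0.ne', Real.rpow_one, ← Real.rpow_mul hd0.le, hQ]
        have e3 : d ^ (3 - 1 / p) * d ^ ((1 - 2 * p) * (1 / p)) = d := by
          rw [← Real.rpow_add hd0]
          have : 3 - 1 / p + (1 - 2 * p) * (1 / p) = 1 := by field_simp; ring
          rw [this, Real.rpow_one]
        calc _ = (d ^ (3 - 1 / p) * d ^ ((1 - 2 * p) * (1 / p))) *
              (4 / ‖Complex.exp (t * Complex.I) - w‖ ^ 2) := by ring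
          _ = _ := by rw [e3]; ring

/-- The radial mean is at most four times the Poisson kernel at `w`, whose mean over the circle is
`1`. -/
theorem rho_peak_le {p : ℝ} (hp : 1 ≤ p) (hw : ‖w‖ < 1) : rho p 1 (peak p w) ≤ 4 := by
  have hpi : ENNReal.ofReal (2 * Real.pi) ≠ 0 := by simp [Real.pi_pos]
  have hw0 := norm_nonneg w
  calc rho p 1 (peak p w) ≤ (ENNReal.ofReal (2 * Real.pi))⁻¹ *
        ∫⁻ t in Ioc (0 : ℝ) (2 * Real.pi), ENNReal.ofReal 4 *
          ENNReal.ofReal ((1 - ‖w‖ ^ 2) / ‖Complex.exp (t * Complex.I) - w‖ ^ 2) := by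
        rw [rho_one]
        gcongr with t
        refine (radialMean_peak_le hp hw t).trans ?_
        rw [← ENNReal.ofReal_mul (by norm_num)]
        apply ENNReal.ofReal_le_ofReal
        rw [mul_div_assoc]
        gcongr
        nlinarith
    _ = 4 := by
        rw [lintegral_const_mul' _ _ ENNReal.ofReal_ne_top, lintegral_poisson hw, mul_left_comm,
          ENNReal.inv_mul_cancel hpi ENNReal.ofReal_ne_top, mul_one]
        norm_num

variable {p : ℝ} [hp : Fact (1 ≤ p)]

/-- The kernel `peak p w` as an element of `RM(p,1)`. -/
def peakRM (p : ℝ) [hp : Fact (1 ≤ p)] (w : ℂ) (hw : ‖w‖ < 1) : RM p 1 :=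
  RM.mk (peak p w) (isHolo_peak p hw)
    ((rho_peak_le hp.out hw).trans_lt (by norm_num))

theorem norm_peakRM_le (hw : ‖w‖ < 1) : ‖peakRM p w hw‖ ≤ 4 := by
  rw [norm_def]
  exact ENNReal.toReal_mono (by norm_num) (rho_peak_le hp.out hw)

theorem le_norm_peak_self (p : ℝ) (hw : ‖w‖ < 1) :
    (1 - ‖w‖) ^ (-1 - 1 / p) / 16 ≤ ‖peak p w w‖ := by
  have hd0 : 0 < 1 - ‖w‖ := by linarith
  have hw0 := norm_nonneg w
  have h1 : ‖1 - starRingEnd ℂ w * w‖ ≤ 2 * (1 - ‖w‖) := by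
    rw [mul_comm, Complex.mul_conj, Complex.normSq_eq_norm_sq, ← Complex.ofReal_one,
      ← Complex.ofReal_sub, Complex.norm_real, Real.norm_of_nonneg (by nlinarith)]
    nlinarith
  have h2 : 0 < ‖1 - starRingEnd ℂ w * w‖ := by
    have := one_sub_le_norm_one_sub_conj_mul w w
    nlinarith
  rw [peak, indicator_of_mem (by simpa using hw), norm_div, norm_pow, Complex.norm_real,
    Real.norm_of_nonneg (by positivity)]
  have e1 : (1 - ‖w‖) ^ (3 - 1 / p) = (1 - ‖w‖) ^ (-1 - 1 / p) * (1 - ‖w‖) ^ 4 := by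
    rw [← Real.rpow_natCast, ← Real.rpow_add hd0]
    congr 1
    push_cast
    ring
  calc (1 - ‖w‖) ^ (-1 - 1 / p) / 16
      = (1 - ‖w‖) ^ (3 - 1 / p) / (2 * (1 - ‖w‖)) ^ 4 := by
        rw [e1]
        field_simp
        norm_num
    _ ≤ _ := by gcongr

/-- At `w` the derivative of the image is `peak p w w * g'(w)`, of size at least `(1 - |w|)^(-2 -
1/p) ε / 16`. This is the growth allowed by `norm_deriv_le`, so the powers cancel; `128 = 16 * 8`.
-/
theorem le_norm_integration_peakRM {g : ℂ → ℂ} (hg : IsBloch g) {T : RM p 1 →L[ℂ] RM p 1}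
    (hT : ∀ f : RM p 1, (T f : ℂ → ℂ) = integrationFun g f) {ε : ℝ} (hw : ‖w‖ < 1)
    (h : ε ≤ (1 - ‖w‖) * ‖deriv g w‖) : ε / 128 ≤ ‖T (peakRM p w hw)‖ := by
  have hd0 : 0 < 1 - ‖w‖ := by linarith
  have h1 := norm_deriv_le (T (peakRM p w hw)) hw
  have h2 : deriv (T (peakRM p w hw)) w = peak p w w * deriv g w := by
    rw [hT]
    exact (hasDerivAt_integrationFun hg.1 (isHolo_peak p hw).1 (by simpa using hw)).deriv
  rw [h2, norm_mul] at h1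
  set D := (1 - ‖w‖) ^ (-2 - 1 / p) with hD
  have hD0 : 0 < D := Real.rpow_pos_of_pos hd0 _
  have h3 : (1 - ‖w‖) ^ (-1 - 1 / p) = D * (1 - ‖w‖) := by
    rw [hD, ← Real.rpow_add_one hd0.ne']
    congr 1
    ring
  have h4 := le_norm_peak_self p hw
  rw [h3] at h4
  have h5 : D * ε / 16 ≤ ‖peak p w w‖ * ‖deriv g w‖ := by
    calc D * ε / 16 ≤ D * ((1 - ‖w‖) * ‖deriv g w‖) / 16 := by gcongr
      _ = D * (1 - ‖w‖) / 16 * ‖deriv g w‖ := by ring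
      _ ≤ _ := by gcongr
  have h6 : D * (ε / 128) ≤ D * ‖T (peakRM p w hw)‖ := by linarith
  exact le_of_mul_le_mul_left h6 hD0

theorem tendsto_radialMean_peak {w : ℕ → ℂ} (hw : ∀ n, ‖w n‖ < 1) {ζ : ℂ} (hζ : ‖ζ‖ = 1)
    (hlim : Filter.Tendsto w Filter.atTop (𝓝 ζ)) {t : ℝ} (ht : Complex.exp (t * Complex.I) ≠ ζ) :
    Filter.Tendsto (fun n => radialMean p (peak p (w n)) t) Filter.atTop (𝓝 0) := by
  have h1 : Filter.Tendsto (fun n => 4 * (1 - ‖w n‖) / ‖Complex.exp (t * Complex.I) - w n‖ ^ 2)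
      Filter.atTop (𝓝 (4 * (1 - ‖ζ‖) / ‖Complex.exp (t * Complex.I) - ζ‖ ^ 2)) := by
    refine Filter.Tendsto.div ((hlim.norm.const_sub 1).const_mul 4)
      ((hlim.const_sub _).norm.pow 2) ?_
    exact pow_ne_zero 2 (norm_ne_zero_iff.2 (sub_ne_zero.2 ht))
  rw [hζ, sub_self, mul_zero, zero_div] at h1
  have h2 := ENNReal.tendsto_ofReal h1
  rw [ENNReal.ofReal_zero] at h2
  exact tendsto_of_tendsto_of_tendsto_of_le_of_le tendsto_const_nhds h2 (fun n => zero_le)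
    fun n => radialMean_peak_le hp.out (hw n) t

end TestFunctions

/-! ### Seminorms localised to sets of angles -/

section AngularSeminorm

variable {p : ℝ} [hp : Fact (1 ≤ p)]

/-- The part of `ρ_{p,1}(f)` carried by a set of angles. -/
def angularMean (p : ℝ) (A : Set ℝ) (f : ℂ → ℂ) : ℝ≥0∞ :=
  (ENNReal.ofReal (2 * Real.pi))⁻¹ *
    ∫⁻ t in A, radialMean p f t ∂(volume.restrict (Ioc (0 : ℝ) (2 * Real.pi)))

theorem angularMean_mono {p : ℝ} {A B : Set ℝ} (h : A ⊆ B) (f : ℂ → ℂ) :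
    angularMean p A f ≤ angularMean p B f := by
  unfold angularMean
  gcongr

theorem angularMean_univ {p : ℝ} (f : ℂ → ℂ) : angularMean p univ f = rho p 1 f := by
  rw [angularMean, rho_one, Measure.restrict_univ]

theorem angularMean_ne_top (A : Set ℝ) (f : RM p 1) : angularMean p A f ≠ ∞ :=
  ne_top_of_le_ne_top f.2.2.ne ((angularMean_mono (subset_univ A) f).trans_eq (angularMean_univ _))

/-- `angularMean` as a seminorm on `RM(p,1)`. -/
def angularSeminorm (p : ℝ) [hp : Fact (1 ≤ p)] (A : Set ℝ) : Seminorm ℂ (RM p 1) :=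
  Seminorm.of (fun f => (angularMean p A f).toReal)
    (fun f f' => by
      rw [← ENNReal.toReal_add (angularMean_ne_top A f) (angularMean_ne_top A f')]
      refine ENNReal.toReal_mono
        (ENNReal.add_ne_top.2 ⟨angularMean_ne_top A f, angularMean_ne_top A f'⟩) ?_
      unfold angularMean
      rw [← mul_add, ← lintegral_add_left (measurable_radialMean f.isHolo.measurable p)]
      gcongr with t
      exact radialMean_add_le hp.out f.isHolo.measurable f'.isHolo.measurable t)
    (fun c f => by
      have h : ∀ t, radialMean p ((c • f : RM p 1) : ℂ → ℂ) t = ‖c‖ₑ * radialMean p f t :=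
        radialMean_smul hp.out c f
      simp only [angularMean, h]
      rw [lintegral_const_mul' _ _ enorm_ne_top, mul_left_comm, ENNReal.toReal_mul, toReal_enorm])

theorem angularSeminorm_apply (A : Set ℝ) (f : RM p 1) :
    angularSeminorm p A f = (angularMean p A f).toReal := rfl

/-- The outer exponent being `1`, the seminorm is additive over disjoint sets of angles. This is the
source of the `ℓ¹` structure. -/
theorem sum_angularSeminorm_le {A : ℕ → Set ℝ} (hm : ∀ n, MeasurableSet (A n))
    (hd : Pairwise (Function.onFun Disjoint A)) {B : Set ℝ} {s : Finset ℕ}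
    (hs : ∀ n ∈ s, A n ⊆ B) (f : RM p 1) :
    ∑ n ∈ s, angularSeminorm p (A n) f ≤ angularSeminorm p B f := by
  simp only [angularSeminorm_apply]
  rw [← ENNReal.toReal_sum fun n _ => angularMean_ne_top (A n) f]
  refine ENNReal.toReal_mono (angularMean_ne_top B f) ?_
  refine le_trans (le_of_eq ?_) (angularMean_mono (iUnion₂_subset hs) _)
  unfold angularMean
  rw [← Finset.mul_sum, lintegral_biUnion_finset (fun i _ j _ hij => hd hij) fun n _ => hm n]

theorem angularSeminorm_univ (f : RM p 1) : angularSeminorm p univ f = ‖f‖ := by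
  rw [angularSeminorm_apply, angularMean_univ, norm_def]

theorem norm_le_angularSeminorm_add_compl {A : Set ℝ} (f : RM p 1) :
    ‖f‖ ≤ angularSeminorm p A f + angularSeminorm p Aᶜ f := by
  rw [← angularSeminorm_univ, angularSeminorm_apply, angularSeminorm_apply, angularSeminorm_apply,
    ← ENNReal.toReal_add (angularMean_ne_top _ f) (angularMean_ne_top _ f)]
  refine ENNReal.toReal_mono
    (ENNReal.add_ne_top.2 ⟨angularMean_ne_top _ f, angularMean_ne_top _ f⟩) ?_
  unfold angularMean
  rw [← mul_add, ← union_compl_self A]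
  gcongr
  exact lintegral_union_le _ _ _

/-- Hahn–Banach, dominated by the seminorm itself rather than a norm, so that the functional stays
localised to the same angles. -/
theorem exists_functional_of_seminorm {E : Type*} [AddCommGroup E] [Module ℂ E]
    (N : Seminorm ℂ E) (x : E) :
    ∃ φ : Module.Dual ℂ E, φ x = N x ∧ ∀ y, ‖φ y‖ ≤ N y := by
  rcases eq_or_ne x 0 with rfl | hx
  · exact ⟨0, by simp, by simp⟩
  have hself : (LinearEquiv.coord ℂ E x hx) ⟨x, Submodule.mem_span_singleton_self x⟩ = 1 :=
    LinearEquiv.coord_self ℂ E x hx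
  obtain ⟨φ, hφ, hle⟩ := Module.Dual.exists_extension_of_le_seminorm (Submodule.span ℂ {x})
    (((N x : ℝ) : ℂ) • (LinearEquiv.coord ℂ E x hx : Submodule.span ℂ {x} →ₗ[ℂ] ℂ)) (p := N)
    fun y => by
      obtain ⟨y, hy⟩ := y
      obtain ⟨c, rfl⟩ := Submodule.mem_span_singleton.1 hy
      have e : (⟨c • x, hy⟩ : Submodule.span ℂ {x}) =
        c • ⟨x, Submodule.mem_span_singleton_self x⟩ := rfl
      rw [e, map_smul, LinearMap.smul_apply, LinearEquiv.coe_coe, hself]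
      simp [map_smul_eq_mul, abs_of_nonneg (apply_nonneg N x)]
  refine ⟨φ, ?_, hle⟩
  have := hφ ⟨x, Submodule.mem_span_singleton_self x⟩
  rw [this, LinearMap.smul_apply, LinearEquiv.coe_coe, hself, smul_eq_mul, mul_one]

end AngularSeminorm

/-! ### The non-compact case: the almost biorthogonal system -/

section Main

variable {p : ℝ} [hp : Fact (1 ≤ p)]

theorem fixesCopy_of_not_little_bloch {g : ℂ → ℂ} (hg : IsBloch g)
    (hlittle : ¬ ∀ ε > 0, ∃ R < 1, ∀ z ∈ ball (0 : ℂ) 1, R ≤ ‖z‖ → (1 - ‖z‖) * ‖deriv g z‖ ≤ ε)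
    (T : RM p 1 →L[ℂ] RM p 1) (hT : ∀ f : RM p 1, (T f : ℂ → ℂ) = integrationFun g f) :
    FixesCopy SeqC0 (dualMap T) ∧ FixesCopy SeqL1 T := by
  push Not at hlittle
  obtain ⟨ε, hε, hR⟩ := hlittle
  choose v hv1 hv2 hv3 using fun n : ℕ => hR (1 - 1 / ((n : ℝ) + 1)) (by
    have : 0 < 1 / ((n : ℝ) + 1) := by positivity
    linarith)
  obtain ⟨ζ, -, ψ, hψ, hψlim⟩ := (isCompact_closedBall (0 : ℂ) 1).tendsto_subseq
    fun n => ball_subset_closedBall (hv1 n)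
  have hv1' : ∀ n, ‖v n‖ < 1 := fun n => mem_ball_zero_iff.1 (hv1 n)
  have hζ : ‖ζ‖ = 1 := by
    have h1 : Filter.Tendsto (fun n => ‖v n‖) Filter.atTop (𝓝 1) := by
      refine tendsto_of_tendsto_of_tendsto_of_le_of_le ?_ tendsto_const_nhds hv2
        fun n => (hv1' n).le
      simpa using tendsto_one_div_add_atTop_nhds_zero_nat (𝕜 := ℝ).const_sub 1
    exact tendsto_nhds_unique hψlim.norm (h1.comp hψ.tendsto_atTop)
  set w : ℕ → ℂ := v ∘ ψ with hwdef
  have hw : ∀ n, ‖w n‖ < 1 := fun n => hv1' _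
  set F : ℕ → RM p 1 := fun n => peakRM p (w n) (hw n) with hF
  have hlow : ∀ n, ε / 128 ≤ ‖T (F n)‖ := fun n =>
    le_norm_integration_peakRM hg hT (hw n) (hv3 _).le
  set μ : Measure ℝ := volume.restrict (Ioc (0 : ℝ) (2 * Real.pi)) with hμ
  have hpi0 : ENNReal.ofReal (2 * Real.pi) ≠ 0 := by simp [Real.pi_pos]
  obtain ⟨K, hK, hKle⟩ := exists_radialMean_integrationFun_le p hg
  have hae : ∀ᵐ t ∂μ, Filter.Tendsto (fun n => radialMean p (T (F n)) t) Filter.atTop (𝓝 0) := by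
    -- The radial means may fail to decay only at the angles of `ζ`, a countable and hence null set.
    have hcount : {t : ℝ | Complex.exp (t * Complex.I) = ζ}.Countable := by
      have := (countable_singleton ζ).preimage_circleMap 0 one_ne_zero
      simpa [preimage, circleMap] using this
    refine ae_restrict_of_ae ?_
    filter_upwards [hcount.ae_notMem volume] with t ht
    have h1 := ENNReal.Tendsto.const_mul (a := K)
      (tendsto_radialMean_peak (p := p) hw hζ hψlim ht) (Or.inr hK)
    rw [mul_zero] at h1
    refine tendsto_of_tendsto_of_tendsto_of_le_of_le tendsto_const_nhds h1 (fun n => zero_le)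
      fun n => ?_
    rw [hT]
    exact hKle _ (isHolo_peak p (hw n)) t
  -- The images have norm at least `ε / 128 = 4 c`. Losing at most `c` off `A k` leaves a diagonal
  -- of at least `3 c` against off-diagonal sums of at most `c`.
  set c := ε / 512 with hc
  have hc0 : 0 < c := by positivity
  obtain ⟨φ, A, -, hAm, hAd, hA⟩ := exists_almost_disjoint (μ := μ)
    (u := fun n => radialMean p (T (F n)))
    (fun n => measurable_radialMean (T (F n)).isHolo.measurable p)
    (fun n hn => by
      have h1 := (T (F n)).2.2.ne
      change rho p 1 (T (F n)) ≠ ∞ at h1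
      rw [rho_one, hn] at h1
      exact h1 (ENNReal.mul_top (ENNReal.inv_ne_zero.2 ENNReal.ofReal_ne_top)))
    hae (ε := ENNReal.ofReal (2 * Real.pi) * ENNReal.ofReal c) (mul_ne_zero hpi0 (by simpa using hc0))
  have hcompl : ∀ k, angularSeminorm p (A k)ᶜ (T (F (φ k))) ≤ c := fun k => by
    rw [angularSeminorm_apply]
    refine ENNReal.toReal_le_of_le_ofReal hc0.le ?_
    calc angularMean p (A k)ᶜ (T (F (φ k))) ≤ (ENNReal.ofReal (2 * Real.pi))⁻¹ *
          (ENNReal.ofReal (2 * Real.pi) * ENNReal.ofReal c) := by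
          unfold angularMean
          gcongr
          exact hA k
      _ = ENNReal.ofReal c := by
          rw [← mul_assoc, ENNReal.inv_mul_cancel hpi0 ENNReal.ofReal_ne_top, one_mul]
  choose Λ hΛ hΛle using fun k =>
    exists_functional_of_seminorm (angularSeminorm p (A k)) (T (F (φ k)))
  have hle1 : ∀ (A : Set ℝ) (y : RM p 1), angularSeminorm p A y ≤ 1 * ‖y‖ := fun A y => by
    rw [one_mul, ← angularSeminorm_univ]
    exact ENNReal.toReal_mono (angularMean_ne_top _ y) (angularMean_mono (subset_univ A) _)
  let Φ : ℕ → StrongDual ℂ (RM p 1) := fun k =>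
    (Λ k).mkContinuous 1 fun y => (hΛle k y).trans (hle1 _ y)
  have hΦ : ∀ k y, ‖Φ k y‖ ≤ angularSeminorm p (A k) y := fun k y => hΛle k y
  have hΦs : ∀ (y : RM p 1) (s : Finset ℕ), ∑ n ∈ s, ‖Φ n y‖ ≤ 1 * ‖y‖ := fun y s =>
    (Finset.sum_le_sum fun n _ => hΦ n y).trans
      ((sum_angularSeminorm_le hAm hAd (fun n _ => subset_univ (A n)) y).trans (hle1 _ y))
  have hdiag : ∀ k, 3 * c ≤ ‖Φ k (T (F (φ k)))‖ := fun k => by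
    have e : Φ k (T (F (φ k))) = (angularSeminorm p (A k) (T (F (φ k))) : ℝ) := hΛ k
    rw [e, Complex.norm_real, Real.norm_of_nonneg (apply_nonneg _ _)]
    have h1 := norm_le_angularSeminorm_add_compl (A := A k) (T (F (φ k)))
    have h2 := hlow (φ k)
    have h3 := hcompl k
    have h4 : ε / 128 = 4 * c := by rw [hc]; ring
    linarith
  have hoff : ∀ (n : ℕ) (s : Finset ℕ), n ∉ s → ∑ m ∈ s, ‖Φ m (T (F (φ n)))‖ ≤ c :=
    fun n s hn => (Finset.sum_le_sum fun m _ => hΦ m _).trans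
      -- Every other `A m` lies in the complement of `A n`, where the `n`-th image has mass at most
      -- `c`.
      ((sum_angularSeminorm_le hAm hAd (B := (A n)ᶜ) (fun m hm =>
        (hAd (ne_of_mem_of_not_mem hm hn)).subset_compl_right) _).trans (hcompl n))
  have hFn : ∀ k, ‖F (φ k)‖ ≤ 4 := fun k => norm_peakRM_le (hw _)
  exact ⟨fixesCopy_seqC0_dualMap T (f := fun k => F (φ k)) hFn hΦs hdiag hc0.le hoff
    (by linarith), fixesCopy_seqL1 T (f := fun k => F (φ k)) hFn hΦs hdiag hoff (by linarith)⟩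

end Main

end RadialMean

end

theorem mainTheorem6 (p : ℝ) [Fact (1 ≤ p)] (g : ℂ → ℂ) (hg : RadialMean.IsBloch g) :
    ∃ T : RadialMean.RM p 1 →L[ℂ] RadialMean.RM p 1,
      (∀ (f : RadialMean.RM p 1) (z : ℂ), z ∈ Metric.ball (0 : ℂ) 1 →
        T f z = RadialMean.integrationOp g f z) ∧
      List.TFAE
        [¬ IsCompactOperator T,
          RadialMean.FixesCopy RadialMean.SeqC0 (RadialMean.dualMap T),
          RadialMean.FixesCopy RadialMean.SeqL1 T] := by
  obtain ⟨T, hT⟩ := RadialMean.exists_integrationCLM p hg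
  refine ⟨T, fun f z hz => ?_, ?_⟩
  · rw [hT, RadialMean.integrationFun, indicator_of_mem hz]
  -- Non-compactness rules out the little Bloch condition, and its failure gives both copies at
  -- once.
  · have key : ¬ IsCompactOperator T → RadialMean.FixesCopy RadialMean.SeqC0 (RadialMean.dualMap T) ∧
        RadialMean.FixesCopy RadialMean.SeqL1 T := fun h =>
      RadialMean.fixesCopy_of_not_little_bloch hg
        (fun hl => h (RadialMean.isCompactOperator_of_little_bloch hg hl T hT)) T hT
    tfae_have 1 → 2 := fun h => (key h).1
    tfae_have 1 → 3 := fun h => (key h).2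
    tfae_have 2 → 1 := RadialMean.not_isCompactOperator_of_fixesCopy_seqC0
    tfae_have 3 → 1 := RadialMean.not_isCompactOperator_of_fixesCopy_seqL1
    tfae_finish
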